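/- Let $k \ge 1$, let $A \in \mathbb{R}^{k\times k}$ be symmetric and positive definite, and let $(N(n))_{n}$ be a strictly increasing sequence of natural numbers. For each $n$ write $N = N(n)$ and let $B_1^{(n)},\dots,B_k^{(n)}$ be a partition of $\{1,\dots,N\}$ into $k$ blocks such that for each $i$ the limit $$\gamma_i := \lim_{n\to\infty} \sqrt{|B_i^{(n)}|/N} > 0$$ exists; put $\Gamma_\infty := \mathrm{diag}(\gamma_1,\dots,\gamma_k)$. Let $J_n \in \mathbb{R}^{N\times N}$ be the matrix with $(J_n)_{vw} = A_{ij}/N$ for $v \in B_i^{(n)}$, $w \in B_j^{(n)}$, and let $\mu_{J_n}$ be the probability measure on $\{-1,+1\}^N$ with $$\mu_{J_n}(x) = Z_n^{-1}\exp\Big(\tfrac12 \sum_{v,w=1}^N (J_n)_{vw} x_v x_w\Big), \qquad Z_n = \sum_{x\in\{-1,+1\}^N} \exp\Big(\tfrac12 \sum_{v,w=1}^N (J_n)_{vw} x_v x_w\Big).$$ Define the normalized block magnetization vector $\hat m^{(n)} = \big(|B_i^{(n)}|^{-1/2} \sum_{v\in B_i^{(n)}} x_v\big)_{i=1,\dots,k}$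 (with $\hat m^{(n)}_i = 0$ if $B_i^{(n)}$ is empty, which can happen for finitely many $n$ only) and $\Sigma_n := \mathbb{E}_{\mu_{J_n}}\, \hat m^{(n)} (\hat m^{(n)})^T$. Let $\mathcal{F}_3$ be the set of all $h \in C^3(\mathbb{R}^k)$ all of whose partial derivatives of orders $1$, $2$ and $3$ are bounded by $1$ in absolute value on $\mathbb{R}^k$. Let $\|\cdot\|_{2\to2}$ be the operator norm with respect to the Euclidean norm, and let $Z \sim \mathcal{N}(0,\mathrm{Id})$ be a standard normal vector in $\mathbb{R}^k$. If $\|\Gamma_\infty A \Gamma_\infty\|_{2\to 2} < 1$, then, as $n \to \infty$, $$\sup_{h\in\mathcal{F}_3} \big|\mathbb{E}_{\mu_{J_n}} h(\hat m^{(n)}) - \mathbb{E}\, h(\Sigma_n^{1/2} Z)\big| = O(N^{-1/2}).$$ In particular all these expectations exist and the supremum is finite for every $n$. -/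

import Mathlib

open MeasureTheory ProbabilityTheory Filter Asymptotics Topology

namespace BlockIsing

/-- Spin configurations in `{-1, +1}^N`; a spin is a unit of `ℤ`. -/
abbrev Config (N : ℕ) : Type := Fin N → ℤˣ

/-- The real value `±1` of the `i`-th spin. -/
def spin {N : ℕ} (x : Config N) (i : Fin N) : ℝ := ((x i : ℤ) : ℝ)

/-- The Hamiltonian `H(x) = ½ ∑ᵢⱼ Jᵢⱼ xᵢ xⱼ`. -/
noncomputable def hamiltonian {N : ℕ} (J : Matrix (Fin N) (Fin N) ℝ) (x : Config N) : ℝ :=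
  (1 / 2) * ∑ i, ∑ j, J i j * spin x i * spin x j

/-- The partition function `∑ₓ exp (H(x))`. -/
noncomputable def partitionFunction {N : ℕ} (J : Matrix (Fin N) (Fin N) ℝ) : ℝ :=
  ∑ x : Config N, Real.exp (hamiltonian J x)

/-- The Ising model with interaction matrix `J`: each configuration `x` has mass
`exp (H(x)) / partitionFunction`. -/
noncomputable def isingMeasure {N : ℕ} (J : Matrix (Fin N) (Fin N) ℝ) : Measure (Config N) :=
  ∑ x : Config N,
    ENNReal.ofReal (Real.exp (hamiltonian J x) / partitionFunction J) • Measure.dirac x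

instance isProbabilityMeasure_isingMeasure {N : ℕ} (J : Matrix (Fin N) (Fin N) ℝ) :
    IsProbabilityMeasure (isingMeasure J) := by
  have hZ : 0 < partitionFunction J :=
    Finset.sum_pos (fun x _ => Real.exp_pos _) Finset.univ_nonempty
  constructor
  simp only [isingMeasure, Measure.coe_finsetSum, Finset.sum_apply, Measure.smul_apply,
    measure_univ, smul_eq_mul, mul_one]
  rw [← ENNReal.ofReal_sum_of_nonneg (fun x _ => div_nonneg (Real.exp_pos _).le hZ.le),
    ← Finset.sum_div]
  change ENNReal.ofReal (partitionFunction J / partitionFunction J) = 1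
  rw [div_self hZ.ne', ENNReal.ofReal_one]

/-- A partition of `{1, …, N}` into `k` labelled blocks is given by the map `b` that sends a
vertex to the label of its block. This is the `i`-th block. -/
def block {N k : ℕ} (b : Fin N → Fin k) (i : Fin k) : Finset (Fin N) :=
  Finset.univ.filter (fun v => b v = i)

/-- The interaction matrix of the block spin Ising model: its entry at two vertices in the
blocks `i` and `j` is `A i j / N`. -/
noncomputable def blockInteraction {N k : ℕ} (A : Matrix (Fin k) (Fin k) ℝ)
    (b : Fin N → Fin k) : Matrix (Fin N) (Fin N) ℝ :=
  Matrix.of fun v w => A (b v) (b w) / (N : ℝ)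

/-- The normalized block magnetization vector, with coordinates
`|Bᵢ|^{-1/2} ∑_{v ∈ Bᵢ} x_v`. -/
noncomputable def magnetization {N k : ℕ} (b : Fin N → Fin k) (x : Config N) :
    EuclideanSpace ℝ (Fin k) :=
  WithLp.toLp 2 fun i => (∑ v ∈ block b i, spin x v) / √((block b i).card : ℝ)

/-- The matrix of second moments of the normalized block magnetization vector under the block
spin Ising model. -/
noncomputable def covMatrix {N k : ℕ} (A : Matrix (Fin k) (Fin k) ℝ) (b : Fin N → Fin k) :
    Matrix (Fin k) (Fin k) ℝ :=
  Matrix.of fun i j =>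
    ∫ x, magnetization b x i * magnetization b x j ∂(isingMeasure (blockInteraction A b))

open scoped MatrixOrder in
/-- `S^{1/2} z` for a positive semidefinite matrix `S`. -/
noncomputable def sqrtApply {k : ℕ} (S : Matrix (Fin k) (Fin k) ℝ)
    (z : EuclideanSpace ℝ (Fin k)) : EuclideanSpace ℝ (Fin k) :=
  Matrix.toEuclideanCLM (𝕜 := ℝ) (CFC.sqrt S) z

/-- The operator norm `‖M‖_{2 → 2}`. -/
noncomputable def opNorm {k : ℕ} (M : Matrix (Fin k) (Fin k) ℝ) : ℝ :=
  ‖Matrix.toEuclideanCLM (n := Fin k) (𝕜 := ℝ) M‖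

/-- The class of `C³` functions on `ℝᵏ` whose partial derivatives of orders 1, 2, 3 are all
bounded by 1 in absolute value. The partial derivative `∂_{α₁} ⋯ ∂_{αⱼ} h (x)` is the `j`-th
derivative at `x` evaluated at the basis vectors `e_{α₁}, …, e_{αⱼ}`. -/
def F₃ (k : ℕ) : Set (EuclideanSpace ℝ (Fin k) → ℝ) :=
  {h | ContDiff ℝ 3 h ∧
    ∀ j ∈ Finset.Icc 1 3, ∀ α : Fin j → Fin k, ∀ x : EuclideanSpace ℝ (Fin k),
      |iteratedFDeriv ℝ j h x (fun l => EuclideanSpace.single (α l) (1 : ℝ))| ≤ 1}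

/-- `|E h(m̂) - E h(Σ^{1/2} Z)|`, where `m̂` is the normalized block magnetization vector under
the block spin Ising model and `Σ` its matrix of second moments. -/
noncomputable def discrepancy {N k : ℕ} (A : Matrix (Fin k) (Fin k) ℝ) (b : Fin N → Fin k)
    {Ω : Type*} [MeasurableSpace Ω] (P : Measure Ω) (Z : Ω → EuclideanSpace ℝ (Fin k))
    (h : EuclideanSpace ℝ (Fin k) → ℝ) : ℝ :=
  |(∫ x, h (magnetization b x) ∂(isingMeasure (blockInteraction A b)))
    - ∫ ω, h (sqrtApply (covMatrix A b) (Z ω)) ∂P|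

end BlockIsing

namespace BlockIsing

/-! ### One-dimensional Gaussian weights -/

/-- The standard Gaussian density times the exponential of a quadratic polynomial is a multiple
of a Gaussian density. -/
lemma gaussianPDFReal_mul_exp_quadratic {a : ℝ} (ha : a < 1) (b c t : ℝ) :
    gaussianPDFReal 0 1 t * Real.exp (a * t ^ 2 / 2 + b * t + c) =
      ((√(1 - a))⁻¹ * Real.exp (c + b ^ 2 / (2 * (1 - a)))) *
        gaussianPDFReal (b / (1 - a)) (Real.toNNReal (1 / (1 - a))) t := by
  have h1 : 0 < 1 - a := by linarith
  have h2 : ((Real.toNNReal (1 / (1 - a)) : NNReal) : ℝ) = 1 / (1 - a) :=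
    Real.coe_toNNReal _ (by positivity)
  rw [gaussianPDFReal_def, gaussianPDFReal_def]
  simp only [h2, NNReal.coe_one, mul_one, sub_zero]
  have h3 : √(2 * Real.pi * (1 / (1 - a))) = √(2 * Real.pi) * (√(1 - a))⁻¹ := by
    rw [Real.sqrt_mul (by positivity), one_div, Real.sqrt_inv]
  have h4 : (√(1 - a)) ≠ 0 := (Real.sqrt_pos.2 h1).ne'
  rw [h3, mul_inv, inv_inv]
  have h5 : ∀ u v w z s r : ℝ, s ≠ 0 → u + v = w + z →
      r⁻¹ * Real.exp u * Real.exp v = (s⁻¹ * Real.exp w) * (r⁻¹ * s * Real.exp z) := by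
    intro u v w z s r hs h
    rw [mul_assoc, ← Real.exp_add, h, Real.exp_add]
    field_simp
  apply h5 _ _ _ _ _ _ h4
  field_simp
  ring

lemma integrable_exp_quadratic_gaussianReal {a : ℝ} (ha : a < 1) (b c : ℝ) :
    Integrable (fun t => Real.exp (a * t ^ 2 / 2 + b * t + c)) (gaussianReal 0 1) := by
  rw [gaussianReal_of_var_ne_zero 0 one_ne_zero,
    integrable_withDensity_iff_integrable_smul' (measurable_gaussianPDF _ _)
      (ae_of_all _ fun _ => gaussianPDF_lt_top)]
  simp only [toReal_gaussianPDF, smul_eq_mul, gaussianPDFReal_mul_exp_quadratic ha]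
  exact (integrable_gaussianPDFReal _ _).const_mul _

lemma integral_exp_quadratic_gaussianReal {a : ℝ} (ha : a < 1) (b c : ℝ) :
    ∫ t, Real.exp (a * t ^ 2 / 2 + b * t + c) ∂(gaussianReal 0 1) =
      (√(1 - a))⁻¹ * Real.exp (c + b ^ 2 / (2 * (1 - a))) := by
  have h1 : 0 < 1 - a := by linarith
  rw [integral_gaussianReal_eq_integral_smul one_ne_zero]
  simp only [smul_eq_mul, gaussianPDFReal_mul_exp_quadratic ha]
  rw [integral_const_mul, integral_gaussianPDFReal_eq_one, mul_one]
  simpa using h1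

/-- The weight `(1 - d)^{-1/2} exp (l x² / (2 (1 - d)))`. For `d = l v` this is the convolution of
`x ↦ exp (l x² / 2)` with the centred Gaussian measure of variance `v`. -/
noncomputable def gaussWeight (l d x : ℝ) : ℝ :=
  (√(1 - d))⁻¹ * Real.exp (l * x ^ 2 / (2 * (1 - d)))

lemma gaussWeight_nonneg (l d x : ℝ) : 0 ≤ gaussWeight l d x := by
  unfold gaussWeight; positivity

@[fun_prop]
lemma continuous_gaussWeight (l d : ℝ) : Continuous (gaussWeight l d) := by
  unfold gaussWeight; fun_prop

lemma gaussWeight_mono {l d d' : ℝ} (hl : 0 ≤ l) (h : d ≤ d') (hd' : d' < 1) (x : ℝ) :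
    gaussWeight l d x ≤ gaussWeight l d' x := by
  have h1 : 0 < 1 - d' := by linarith
  have h2 : 0 < √(1 - d') := Real.sqrt_pos.2 h1
  unfold gaussWeight
  gcongr

lemma gaussWeight_avg_le {l d d' s x : ℝ} (hl : 0 ≤ l) (h : d + l * s ^ 2 ≤ d')
    (hd' : d' < 1) :
    (gaussWeight l d (x + s) + gaussWeight l d (x - s)) / 2 ≤ gaussWeight l d' x := by
  have hls : 0 ≤ l * s ^ 2 := by positivity
  refine le_trans ?_ (gaussWeight_mono hl h hd' x)
  have h1 : 0 < 1 - d := by linarith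
  have h0 : 0 < 1 - (d + l * s ^ 2) := by linarith
  set m := l / (1 - d) with hm
  have hm0 : 0 ≤ m := by positivity
  have hmd : 1 - (d + l * s ^ 2) = (1 - d) * (1 - m * s ^ 2) := by
    rw [hm]; field_simp; ring
  have h2 : 0 < 1 - m * s ^ 2 := by
    rw [hmd] at h0; exact (pos_iff_pos_of_mul_pos h0).1 h1
  have e1 : ∀ y, gaussWeight l d y = (√(1 - d))⁻¹ * Real.exp (m * y ^ 2 / 2) := by
    intro y; unfold gaussWeight; congr 2; rw [hm]; field_simp
  have e2 : gaussWeight l (d + l * s ^ 2) x =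
      (√(1 - d))⁻¹ * ((√(1 - m * s ^ 2))⁻¹ * Real.exp (m * x ^ 2 / (2 * (1 - m * s ^ 2)))) := by
    unfold gaussWeight
    rw [hmd, Real.sqrt_mul h1.le, mul_inv, mul_assoc]
    congr 3
    rw [hm]; field_simp
  rw [e1, e1, e2]
  have e3 : ((√(1 - d))⁻¹ * Real.exp (m * (x + s) ^ 2 / 2) +
      (√(1 - d))⁻¹ * Real.exp (m * (x - s) ^ 2 / 2)) / 2 =
      (√(1 - d))⁻¹ * (Real.exp (m * s ^ 2 / 2) * (Real.exp (m * x ^ 2 / 2) *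
        Real.cosh (m * x * s))) := by
    rw [Real.cosh_eq,
      show m * (x + s) ^ 2 / 2 = m * s ^ 2 / 2 + (m * x ^ 2 / 2 + m * x * s) by ring,
      show m * (x - s) ^ 2 / 2 = m * s ^ 2 / 2 + (m * x ^ 2 / 2 + -(m * x * s)) by ring]
    simp only [Real.exp_add]
    ring
  rw [e3]
  gcongr
  · rw [show m * s ^ 2 / 2 = (m * s ^ 2) / 2 by ring, Real.exp_half]
    rw [← Real.sqrt_inv]
    apply Real.sqrt_le_sqrt
    rw [le_inv_comm₀ (Real.exp_pos _) h2, ← Real.exp_neg]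
    have := Real.add_one_le_exp (-(m * s ^ 2))
    linarith
  · calc Real.exp (m * x ^ 2 / 2) * Real.cosh (m * x * s)
        ≤ Real.exp (m * x ^ 2 / 2) * Real.exp ((m * x * s) ^ 2 / 2) := by
          gcongr; exact Real.cosh_le_exp_half_sq _
      _ = Real.exp (m * x ^ 2 / 2 + (m * x * s) ^ 2 / 2) := (Real.exp_add _ _).symm
      _ ≤ _ := by
          apply Real.exp_le_exp.2
          rw [le_div_iff₀ (by positivity)]
          have : 0 ≤ m * x ^ 2 * (m * s ^ 2) ^ 2 := by positivity
          nlinarith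

/-- Convolution of the weight with a Gaussian measure, with an extra factor `exp (e t² / 2)`. -/
lemma integral_exp_mul_gaussWeight {l d s x e : ℝ} (hd : d < 1) (he : e < 1)
    (h : d + l * s ^ 2 / (1 - e) < 1) :
    Integrable (fun t => Real.exp (e * t ^ 2 / 2) * gaussWeight l d (x + s * t))
      (gaussianReal 0 1) ∧
    ∫ t, Real.exp (e * t ^ 2 / 2) * gaussWeight l d (x + s * t) ∂(gaussianReal 0 1) =
      (√(1 - e))⁻¹ * gaussWeight l (d + l * s ^ 2 / (1 - e)) x := by
  have h1 : 0 < 1 - d := by linarith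
  have h2 : 0 < 1 - e := by linarith
  have h0 : 0 < 1 - (d + l * s ^ 2 / (1 - e)) := by linarith
  set m := l / (1 - d) with hm
  have hmd : (1 - d) * (1 - (e + m * s ^ 2)) = (1 - e) * (1 - (d + l * s ^ 2 / (1 - e))) := by
    rw [hm]; field_simp; ring
  have h3 : e + m * s ^ 2 < 1 := by
    have : 0 < (1 - d) * (1 - (e + m * s ^ 2)) := by rw [hmd]; positivity
    have := (pos_iff_pos_of_mul_pos this).1 h1
    linarith
  have h4 : 0 < 1 - (e + m * s ^ 2) := by linarith
  have e1 : (fun t => Real.exp (e * t ^ 2 / 2) * gaussWeight l d (x + s * t)) =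
      fun t => (√(1 - d))⁻¹ *
        Real.exp ((e + m * s ^ 2) * t ^ 2 / 2 + (m * x * s) * t + m * x ^ 2 / 2) := by
    funext t
    unfold gaussWeight
    rw [mul_left_comm, ← Real.exp_add]
    congr 2
    rw [hm]; field_simp; ring
  rw [e1]
  refine ⟨(integrable_exp_quadratic_gaussianReal h3 _ _).const_mul _, ?_⟩
  rw [integral_const_mul, integral_exp_quadratic_gaussianReal h3]
  unfold gaussWeight
  rw [← mul_assoc, ← mul_assoc, ← mul_inv, ← mul_inv, ← Real.sqrt_mul h1.le,
    ← Real.sqrt_mul h2.le, hmd]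
  congr 2
  have h5 : 1 - (e + m * s ^ 2) = (1 - e) * (1 - (d + l * s ^ 2 / (1 - e))) / (1 - d) := by
    rw [← hmd]; field_simp
  have h6 : (1 - e) * (1 - d) - l * s ^ 2 ≠ 0 := by
    have : (1 - e) * (1 - (d + l * s ^ 2 / (1 - e))) = (1 - e) * (1 - d) - l * s ^ 2 := by
      field_simp; ring
    rw [← this]; positivity
  rw [h5, hm]
  have h7 : 1 - (d + l * s ^ 2 / (1 - e)) = ((1 - e) * (1 - d) - l * s ^ 2) / (1 - e) := by
    field_simp; ring
  rw [h7]
  obtain ⟨q, hq⟩ : ∃ q, q = (1 - e) * (1 - d) - l * s ^ 2 := ⟨_, rfl⟩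
  rw [← hq] at h6 ⊢
  field_simp
  rw [hq]
  ring

lemma integral_gaussWeight_le {l d d' s x : ℝ} (hl : 0 ≤ l) (h : d + l * s ^ 2 ≤ d')
    (hd' : d' < 1) :
    Integrable (fun t => gaussWeight l d (x + s * t)) (gaussianReal 0 1) ∧
    ∫ t, gaussWeight l d (x + s * t) ∂(gaussianReal 0 1) ≤ gaussWeight l d' x := by
  have hls : 0 ≤ l * s ^ 2 := by positivity
  have := integral_exp_mul_gaussWeight (l := l) (d := d) (s := s) (x := x) (e := 0)
    (by linarith) (by norm_num) (by simp; linarith)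
  simp only [zero_mul, zero_div, Real.exp_zero, one_mul, sub_zero, Real.sqrt_one, inv_one,
    div_one] at this
  exact ⟨this.1, this.2.trans_le (gaussWeight_mono hl h hd' x)⟩

lemma abs_pow_three_le_exp {e : ℝ} (he : 0 < e) (t : ℝ) :
    |t| ^ 3 ≤ (1 + 8 / e ^ 2) * Real.exp (e * t ^ 2 / 2) := by
  have h1 : (e * t ^ 2 / 2) ^ 2 / 2 ≤ Real.exp (e * t ^ 2 / 2) := by
    have := Real.quadratic_le_exp_of_nonneg (x := e * t ^ 2 / 2) (by positivity)
    have : 0 ≤ e * t ^ 2 / 2 := by positivity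
    linarith
  have h2 : 1 ≤ Real.exp (e * t ^ 2 / 2) := Real.one_le_exp (by positivity)
  have h3 : |t| ^ 3 ≤ 1 + t ^ 4 := by
    have h : t ^ 4 = |t| ^ 4 := (Even.pow_abs (by decide) t).symm
    rw [h]
    nlinarith [sq_nonneg (|t| ^ 2 - |t|), sq_nonneg (|t| - 1), abs_nonneg t, sq_nonneg (|t|^2)]
  have h4 : t ^ 4 = 8 / e ^ 2 * ((e * t ^ 2 / 2) ^ 2 / 2) := by field_simp; ring
  calc |t| ^ 3 ≤ 1 + t ^ 4 := h3
    _ = 1 + 8 / e ^ 2 * ((e * t ^ 2 / 2) ^ 2 / 2) := by rw [← h4]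
    _ ≤ Real.exp (e * t ^ 2 / 2) + 8 / e ^ 2 * Real.exp (e * t ^ 2 / 2) := by gcongr
    _ = _ := by ring

/-- The constant in the Gaussian third moment bound for the weights. -/
noncomputable def thirdMomentConst (e : ℝ) : ℝ := (1 + 8 / e ^ 2) * (√(1 - e))⁻¹

lemma integral_abs_pow_three_mul_gaussWeight_le {l d d' s x e : ℝ} (hl : 0 ≤ l)
    (he0 : 0 < e) (he : e < 1) (h : d + l * s ^ 2 / (1 - e) ≤ d') (hd' : d' < 1) :
    Integrable (fun t => |t| ^ 3 * gaussWeight l d (x + s * t)) (gaussianReal 0 1) ∧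
    ∫ t, |t| ^ 3 * gaussWeight l d (x + s * t) ∂(gaussianReal 0 1) ≤
      thirdMomentConst e * gaussWeight l d' x := by
  have h1e : 0 < 1 - e := by linarith
  have hls : 0 ≤ l * s ^ 2 / (1 - e) := by positivity
  obtain ⟨h1, h2⟩ := integral_exp_mul_gaussWeight (l := l) (d := d) (s := s) (x := x) (e := e)
    (by linarith) he (by linarith)
  have hb : ∀ t, |t| ^ 3 * gaussWeight l d (x + s * t) ≤
      (1 + 8 / e ^ 2) * (Real.exp (e * t ^ 2 / 2) * gaussWeight l d (x + s * t)) := by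
    intro t
    rw [← mul_assoc]
    exact mul_le_mul_of_nonneg_right (abs_pow_three_le_exp he0 t) (gaussWeight_nonneg _ _ _)
  have hi : Integrable (fun t => |t| ^ 3 * gaussWeight l d (x + s * t)) (gaussianReal 0 1) := by
    refine (h1.const_mul (1 + 8 / e ^ 2)).mono' ?_ (ae_of_all _ fun t => ?_)
    · exact Continuous.aestronglyMeasurable (by fun_prop)
    · rw [Real.norm_of_nonneg (mul_nonneg (by positivity) (gaussWeight_nonneg _ _ _))]
      exact hb t
  refine ⟨hi, (integral_mono hi (h1.const_mul _) hb).trans ?_⟩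
  rw [integral_const_mul, h2, thirdMomentConst, mul_assoc]
  gcongr
  exact gaussWeight_mono hl h hd' x

/-! ### Weights on `ℝᵏ` -/

variable {k : ℕ}

/-- The product over the coordinates of the weights `gaussWeight l (d i)`. -/
noncomputable def weight (l : ℝ) (d : Fin k → ℝ) (x : EuclideanSpace ℝ (Fin k)) : ℝ :=
  ∏ i, gaussWeight l (d i) (x i)

lemma weight_nonneg (l : ℝ) (d : Fin k → ℝ) (x : EuclideanSpace ℝ (Fin k)) :
    0 ≤ weight l d x :=
  Finset.prod_nonneg fun _ _ => gaussWeight_nonneg _ _ _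

@[fun_prop]
lemma continuous_weight (l : ℝ) (d : Fin k → ℝ) : Continuous (weight l d) := by
  unfold weight; fun_prop

lemma weight_zero_eq (l : ℝ) (x : EuclideanSpace ℝ (Fin k)) :
    weight l 0 x = Real.exp (l * ‖x‖ ^ 2 / 2) := by
  simp [weight, gaussWeight, ← Real.exp_sum, EuclideanSpace.norm_sq_eq, Finset.mul_sum,
    Finset.sum_div]

lemma weight_mono {l : ℝ} {d d' : Fin k → ℝ} (hl : 0 ≤ l) (h : ∀ i, d i ≤ d' i)
    (hd' : ∀ i, d' i < 1) (x : EuclideanSpace ℝ (Fin k)) : weight l d x ≤ weight l d' x :=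
  Finset.prod_le_prod (fun _ _ => gaussWeight_nonneg _ _ _)
    fun i _ => gaussWeight_mono hl (h i) (hd' i) _

lemma weight_add_single (l : ℝ) (d : Fin k → ℝ) (x : EuclideanSpace ℝ (Fin k)) (i : Fin k)
    (t : ℝ) : weight l d (x + EuclideanSpace.single i t) =
      gaussWeight l (d i) (x i + t) *
        ∏ j ∈ Finset.univ.erase i, gaussWeight l (d j) (x j) := by
  rw [weight, ← Finset.mul_prod_erase _ _ (Finset.mem_univ i)]
  congr 1
  · simp
  · refine Finset.prod_congr rfl fun j hj => ?_
    simp [Finset.ne_of_mem_erase hj]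

lemma weight_eq_mul_prod_erase {l : ℝ} {d d' : Fin k → ℝ} {i : Fin k}
    (hne : ∀ j, j ≠ i → d' j = d j) (x : EuclideanSpace ℝ (Fin k)) :
    weight l d' x = gaussWeight l (d' i) (x i) *
        ∏ j ∈ Finset.univ.erase i, gaussWeight l (d j) (x j) := by
  rw [weight, ← Finset.mul_prod_erase _ _ (Finset.mem_univ i)]
  congr 1
  exact Finset.prod_congr rfl fun j hj => by rw [hne j (Finset.ne_of_mem_erase hj)]

lemma prod_erase_nonneg (l : ℝ) (d : Fin k → ℝ) (i : Fin k) (x : EuclideanSpace ℝ (Fin k)) :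
    0 ≤ ∏ j ∈ Finset.univ.erase i, gaussWeight l (d j) (x j) :=
  Finset.prod_nonneg fun _ _ => gaussWeight_nonneg _ _ _

section Step

variable {l e s : ℝ} {d d' : Fin k → ℝ} {i : Fin k}

lemma weight_avg_le (hl : 0 ≤ l) (hne : ∀ j, j ≠ i → d' j = d j)
    (hi : d i + l * s ^ 2 ≤ d' i) (hlt : d' i < 1) (x : EuclideanSpace ℝ (Fin k)) :
    (weight l d (x + EuclideanSpace.single i s) + weight l d (x + EuclideanSpace.single i (-s))) / 2
      ≤ weight l d' x := by
  rw [weight_add_single, weight_add_single, weight_eq_mul_prod_erase hne, ← add_mul,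
    mul_div_right_comm, ← sub_eq_add_neg]
  exact mul_le_mul_of_nonneg_right (gaussWeight_avg_le hl hi hlt) (prod_erase_nonneg _ _ _ _)

lemma integral_weight_le (hl : 0 ≤ l) (hne : ∀ j, j ≠ i → d' j = d j)
    (hi : d i + l * s ^ 2 ≤ d' i) (hlt : d' i < 1) (x : EuclideanSpace ℝ (Fin k)) :
    Integrable (fun t => weight l d (x + EuclideanSpace.single i (s * t))) (gaussianReal 0 1) ∧
    ∫ t, weight l d (x + EuclideanSpace.single i (s * t)) ∂(gaussianReal 0 1)
      ≤ weight l d' x := by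
  simp only [weight_add_single, weight_eq_mul_prod_erase hne]
  obtain ⟨h1, h2⟩ := integral_gaussWeight_le (x := x i) hl hi hlt
  refine ⟨h1.mul_const _, ?_⟩
  rw [integral_mul_const]
  exact mul_le_mul_of_nonneg_right h2 (prod_erase_nonneg _ _ _ _)

lemma integral_abs_pow_three_mul_weight_le (hl : 0 ≤ l) (he0 : 0 < e) (he : e < 1)
    (hne : ∀ j, j ≠ i → d' j = d j)
    (hi : d i + l * s ^ 2 / (1 - e) ≤ d' i) (hlt : d' i < 1) (x : EuclideanSpace ℝ (Fin k)) :
    Integrable (fun t => |t| ^ 3 * weight l d (x + EuclideanSpace.single i (s * t)))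
      (gaussianReal 0 1) ∧
    ∫ t, |t| ^ 3 * weight l d (x + EuclideanSpace.single i (s * t)) ∂(gaussianReal 0 1)
      ≤ thirdMomentConst e * weight l d' x := by
  simp only [weight_add_single, weight_eq_mul_prod_erase hne, ← mul_assoc]
  obtain ⟨h1, h2⟩ := integral_abs_pow_three_mul_gaussWeight_le (x := x i) hl he0 he hi hlt
  refine ⟨h1.mul_const _, ?_⟩
  rw [integral_mul_const]
  exact mul_le_mul_of_nonneg_right h2 (prod_erase_nonneg _ _ _ _)

end Step

/-! ### Rademacher and Gaussian sums -/

/-- `rademacherAvg δ L f x` is the expectation of `f (x + ∑_{i ∈ L} ε_i √(δ i) e_i)` with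
independent uniform signs `ε`. -/
noncomputable def rademacherAvg (δ : Fin k → ℝ) :
    List (Fin k) → (EuclideanSpace ℝ (Fin k) → ℝ) → EuclideanSpace ℝ (Fin k) → ℝ
  | [], f, x => f x
  | i :: L, f, x => (rademacherAvg δ L f (x + EuclideanSpace.single i (√(δ i))) +
      rademacherAvg δ L f (x + EuclideanSpace.single i (-√(δ i)))) / 2

/-- The law of `∑_{i ∈ L} g_i √(δ i) e_i` with independent standard Gaussian `g`. -/
noncomputable def gaussianSum (δ : Fin k → ℝ) :
    List (Fin k) → Measure (EuclideanSpace ℝ (Fin k))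
  | [] => Measure.dirac 0
  | i :: L => ((gaussianReal 0 1).map fun t => EuclideanSpace.single i (√(δ i) * t)).conv
      (gaussianSum δ L)

@[fun_prop]
lemma continuous_single (i : Fin k) :
    Continuous fun t : ℝ => (EuclideanSpace.single i t : EuclideanSpace ℝ (Fin k)) := by
  have h : (fun t : ℝ => (EuclideanSpace.single i t : EuclideanSpace ℝ (Fin k))) =
      fun t => t • EuclideanSpace.single i (1 : ℝ) := by
    ext t j; simp
  rw [h]; fun_prop

instance isProbabilityMeasure_map_single (i : Fin k) (s : ℝ) : IsProbabilityMeasure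
    ((gaussianReal 0 1).map fun t => (EuclideanSpace.single i (s * t) :
      EuclideanSpace ℝ (Fin k))) :=
  Measure.isProbabilityMeasure_map (Continuous.aemeasurable (by fun_prop))

instance isProbabilityMeasure_gaussianSum (δ : Fin k → ℝ) (L : List (Fin k)) :
    IsProbabilityMeasure (gaussianSum δ L) := by
  induction L with
  | nil => unfold gaussianSum; infer_instance
  | cons i L ih => unfold gaussianSum; infer_instance

/-- The exponent parameter of the weight after adding the summands in `L`. -/
def budget (c : ℝ) (δ : Fin k → ℝ) (L : List (Fin k)) : Fin k → ℝ :=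
  fun j => c * δ j * L.count j

lemma budget_cons_of_ne (c : ℝ) (δ : Fin k → ℝ) (L : List (Fin k)) {i j : Fin k} (h : j ≠ i) :
    budget c δ (i :: L) j = budget c δ L j := by
  simp [budget, List.count_cons_of_ne h.symm]

lemma budget_cons_self (c : ℝ) (δ : Fin k → ℝ) (L : List (Fin k)) (i : Fin k) :
    budget c δ (i :: L) i = budget c δ L i + c * δ i := by
  simp [budget]; ring

lemma budget_le_cons {c : ℝ} (hc : 0 ≤ c) {δ : Fin k → ℝ} (hδ : ∀ j, 0 ≤ δ j)
    (L : List (Fin k)) (i j : Fin k) : budget c δ L j ≤ budget c δ (i :: L) j := by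
  by_cases h : j = i
  · subst h; rw [budget_cons_self]; have := mul_nonneg hc (hδ j); linarith
  · rw [budget_cons_of_ne _ _ _ h]

section Lindeberg

variable {l e : ℝ} {δ : Fin k → ℝ}

lemma budget_step (hl : 0 ≤ l) (he0 : 0 ≤ e) (he : e < 1) (hδ : ∀ j, 0 ≤ δ j)
    (L : List (Fin k)) (i : Fin k) :
    budget (l / (1 - e)) δ L i + l * √(δ i) ^ 2 / (1 - e) = budget (l / (1 - e)) δ (i :: L) i ∧
    budget (l / (1 - e)) δ L i + l * √(δ i) ^ 2 ≤ budget (l / (1 - e)) δ (i :: L) i := by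
  have h1 : 0 < 1 - e := by linarith
  rw [budget_cons_self, Real.sq_sqrt (hδ i)]
  refine ⟨by ring, ?_⟩
  have h2 : l * δ i ≤ l / (1 - e) * δ i := by
    apply mul_le_mul_of_nonneg_right _ (hδ i)
    rw [le_div_iff₀ h1]; nlinarith
  linarith

lemma continuous_rademacherAvg {f : EuclideanSpace ℝ (Fin k) → ℝ} (hf : Continuous f)
    (L : List (Fin k)) : Continuous (rademacherAvg δ L f) := by
  induction L with
  | nil => exact hf
  | cons i L ih => simp only [rademacherAvg]; fun_prop

lemma budget_lt_one_of_cons (hl : 0 ≤ l) (he : e < 1) (hδ : ∀ j, 0 ≤ δ j)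
    {L : List (Fin k)} {i : Fin k} (h : ∀ j, budget (l / (1 - e)) δ (i :: L) j < 1) (j : Fin k) :
    budget (l / (1 - e)) δ L j < 1 :=
  (budget_le_cons (div_nonneg hl (by linarith)) hδ L i j).trans_lt (h j)

lemma abs_rademacherAvg_le (hl : 0 ≤ l) (he0 : 0 ≤ e) (he : e < 1) (hδ : ∀ j, 0 ≤ δ j)
    {f : EuclideanSpace ℝ (Fin k) → ℝ} {C : ℝ} (hC : 0 ≤ C) (hf : ∀ x, |f x| ≤ C * weight l 0 x)
    (L : List (Fin k)) (hL : ∀ j, budget (l / (1 - e)) δ L j < 1)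
    (x : EuclideanSpace ℝ (Fin k)) :
    |rademacherAvg δ L f x| ≤ C * weight l (budget (l / (1 - e)) δ L) x := by
  induction L generalizing x with
  | nil =>
    have : budget (l / (1 - e)) δ [] = 0 := by ext; simp [budget]
    rw [this]; exact hf x
  | cons i L ih =>
    have ih := ih (budget_lt_one_of_cons hl he hδ hL)
    have h1 := weight_avg_le hl (fun j => budget_cons_of_ne (l / (1 - e)) δ L)
      (budget_step hl he0 he hδ L i).2 (hL i) x
    have h2 := mul_le_mul_of_nonneg_left h1 hC
    have h3 := ih (x + EuclideanSpace.single i (√(δ i)))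
    have h4 := ih (x + EuclideanSpace.single i (-√(δ i)))
    simp only [rademacherAvg]
    rw [abs_le] at *
    constructor <;> linarith

lemma rademacherAvg_taylor (hl : 0 ≤ l) (he0 : 0 ≤ e) (he : e < 1) (hδ : ∀ j, 0 ≤ δ j)
    {f f₁ f₂ : EuclideanSpace ℝ (Fin k) → ℝ} {C : ℝ} (hC : 0 ≤ C) (i : Fin k)
    (hf : ∀ x t, |f (x + EuclideanSpace.single i t) - f x - f₁ x * t - f₂ x * t ^ 2| ≤
      C * |t| ^ 3 * (weight l 0 x + weight l 0 (x + EuclideanSpace.single i t)))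
    (L : List (Fin k)) (hL : ∀ j, budget (l / (1 - e)) δ L j < 1)
    (x : EuclideanSpace ℝ (Fin k)) (t : ℝ) :
    |rademacherAvg δ L f (x + EuclideanSpace.single i t) - rademacherAvg δ L f x
      - rademacherAvg δ L f₁ x * t - rademacherAvg δ L f₂ x * t ^ 2| ≤
      C * |t| ^ 3 * (weight l (budget (l / (1 - e)) δ L) x +
        weight l (budget (l / (1 - e)) δ L) (x + EuclideanSpace.single i t)) := by
  induction L generalizing x with
  | nil =>
    have : budget (l / (1 - e)) δ [] = 0 := by ext; simp [budget]
    rw [this]; exact hf x t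
  | cons j L ih =>
    have ih := ih (budget_lt_one_of_cons hl he hδ hL)
    have hw := weight_avg_le hl (fun j' => budget_cons_of_ne (l / (1 - e)) δ L)
      (budget_step hl he0 he hδ L j).2 (hL j)
    have h1 := mul_le_mul_of_nonneg_left (add_le_add (hw x) (hw (x + EuclideanSpace.single i t)))
      (by positivity : 0 ≤ C * |t| ^ 3)
    have h3 := ih (x + EuclideanSpace.single j (√(δ j)))
    have h4 := ih (x + EuclideanSpace.single j (-√(δ j)))
    rw [add_right_comm] at h3 h4
    simp only [rademacherAvg]
    rw [abs_le] at *
    constructor <;> linarith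

lemma lintegral_gaussianSum_cons {F : EuclideanSpace ℝ (Fin k) → ENNReal} (hF : Measurable F)
    (i : Fin k) (L : List (Fin k)) (x : EuclideanSpace ℝ (Fin k)) :
    ∫⁻ y, F (x + y) ∂(gaussianSum δ (i :: L)) =
      ∫⁻ t, ∫⁻ y, F (x + EuclideanSpace.single i (√(δ i) * t) + y) ∂(gaussianSum δ L)
        ∂(gaussianReal 0 1) := by
  rw [gaussianSum, Measure.lintegral_conv (by fun_prop), lintegral_map]
  · simp only [add_assoc]
  · fun_prop
  · exact Continuous.measurable (by fun_prop)

lemma lintegral_weight_gaussianSum_le (hl : 0 ≤ l) (he0 : 0 ≤ e) (he : e < 1)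
    (hδ : ∀ j, 0 ≤ δ j) (L : List (Fin k)) (hL : ∀ j, budget (l / (1 - e)) δ L j < 1)
    (x : EuclideanSpace ℝ (Fin k)) :
    ∫⁻ y, ENNReal.ofReal (weight l 0 (x + y)) ∂(gaussianSum δ L) ≤
      ENNReal.ofReal (weight l (budget (l / (1 - e)) δ L) x) := by
  induction L generalizing x with
  | nil =>
    have : budget (l / (1 - e)) δ [] = 0 := by ext; simp [budget]
    simp [gaussianSum, this]
  | cons i L ih =>
    have ih := ih (budget_lt_one_of_cons hl he hδ hL)
    rw [lintegral_gaussianSum_cons (F := fun y => ENNReal.ofReal (weight l 0 y))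
      (continuous_weight l 0).measurable.ennreal_ofReal]
    refine (lintegral_mono fun t => ih _).trans ?_
    obtain ⟨h1, h2⟩ := integral_weight_le hl (fun j => budget_cons_of_ne (l / (1 - e)) δ L)
      (budget_step hl he0 he hδ L i).2 (hL i) x
    rw [← ofReal_integral_eq_lintegral_ofReal h1 (ae_of_all _ fun _ => weight_nonneg _ _ _)]
    exact ENNReal.ofReal_le_ofReal h2

lemma integrable_gaussianSum (hl : 0 ≤ l) (he0 : 0 ≤ e) (he : e < 1)
    (hδ : ∀ j, 0 ≤ δ j) {f : EuclideanSpace ℝ (Fin k) → ℝ} (hfc : Continuous f) {C : ℝ}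
    (hf : ∀ x, |f x| ≤ C * weight l 0 x)
    (L : List (Fin k)) (hL : ∀ j, budget (l / (1 - e)) δ L j < 1)
    (x : EuclideanSpace ℝ (Fin k)) :
    Integrable (fun y => f (x + y)) (gaussianSum δ L) := by
  have h1 : Integrable (fun y => weight l 0 (x + y)) (gaussianSum δ L) := by
    refine ⟨Continuous.aestronglyMeasurable (by fun_prop), ?_⟩
    rw [hasFiniteIntegral_iff_ofReal (ae_of_all _ fun _ => weight_nonneg _ _ _)]
    exact (lintegral_weight_gaussianSum_le hl he0 he hδ L hL x).trans_lt ENNReal.ofReal_lt_top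
  exact (h1.const_mul C).mono' (Continuous.aestronglyMeasurable (by fun_prop))
    (ae_of_all _ fun y => hf _)

lemma abs_integral_gaussianSum_le (hl : 0 ≤ l) (he0 : 0 ≤ e) (he : e < 1)
    (hδ : ∀ j, 0 ≤ δ j) {f : EuclideanSpace ℝ (Fin k) → ℝ} {C : ℝ}
    (hC : 0 ≤ C) (hf : ∀ x, |f x| ≤ C * weight l 0 x)
    (L : List (Fin k)) (hL : ∀ j, budget (l / (1 - e)) δ L j < 1)
    (x : EuclideanSpace ℝ (Fin k)) :
    |∫ y, f (x + y) ∂(gaussianSum δ L)| ≤ C * weight l (budget (l / (1 - e)) δ L) x := by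
  have h0 := lintegral_weight_gaussianSum_le hl he0 he hδ L hL x
  have h1 : Integrable (fun y => weight l 0 (x + y)) (gaussianSum δ L) :=
    integrable_gaussianSum (C := 1) hl he0 he hδ (by fun_prop)
      (fun x => by rw [abs_of_nonneg (weight_nonneg _ _ _), one_mul]) L hL x
  have h2 : ∫ y, weight l 0 (x + y) ∂(gaussianSum δ L) ≤ weight l (budget (l / (1 - e)) δ L) x := by
    rw [← ofReal_integral_eq_lintegral_ofReal h1 (ae_of_all _ fun _ => weight_nonneg _ _ _)] at h0
    exact (ENNReal.ofReal_le_ofReal_iff (weight_nonneg _ _ _)).1 h0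
  calc |∫ y, f (x + y) ∂(gaussianSum δ L)| ≤ ∫ y, C * weight l 0 (x + y) ∂(gaussianSum δ L) :=
        norm_integral_le_of_norm_le (f := fun y => f (x + y)) (h1.const_mul C)
          (ae_of_all _ fun y => hf (x + y))
    _ = C * ∫ y, weight l 0 (x + y) ∂(gaussianSum δ L) := integral_const_mul _ _
    _ ≤ _ := by gcongr

lemma integral_gaussianSum_cons {f : EuclideanSpace ℝ (Fin k) → ℝ} {i : Fin k} {L : List (Fin k)}
    {x : EuclideanSpace ℝ (Fin k)} (hfc : Continuous f)
    (hf : Integrable (fun y => f (x + y)) (gaussianSum δ (i :: L))) :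
    ∫ y, f (x + y) ∂(gaussianSum δ (i :: L)) =
      ∫ t, ∫ y, f (x + EuclideanSpace.single i (√(δ i) * t) + y) ∂(gaussianSum δ L)
        ∂(gaussianReal 0 1) := by
  rw [gaussianSum] at hf ⊢
  rw [integral_conv hf, integral_map]
  · simp only [add_assoc]
  · exact Continuous.aemeasurable (by fun_prop)
  · apply StronglyMeasurable.aestronglyMeasurable
    apply StronglyMeasurable.integral_prod_right'
      (f := fun p : EuclideanSpace ℝ (Fin k) × EuclideanSpace ℝ (Fin k) => f (x + (p.1 + p.2)))
    exact Continuous.stronglyMeasurable (by fun_prop)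

/-- Replacing one Rademacher summand by a Gaussian one. -/
lemma abs_avg_sub_integral_le (hl : 0 ≤ l) (he0 : 0 < e) (he : e < 1)
    {u : EuclideanSpace ℝ (Fin k) → ℝ} (hu : Continuous u) {C s a₁ a₂ : ℝ} (hC : 0 ≤ C)
    (hs : 0 ≤ s) {d d' : Fin k → ℝ} {i : Fin k} (hne : ∀ j, j ≠ i → d' j = d j)
    (hi : d i + l * s ^ 2 / (1 - e) ≤ d' i) (hlt : ∀ j, d' j < 1) (x : EuclideanSpace ℝ (Fin k))
    (ht : ∀ t, |u (x + EuclideanSpace.single i t) - u x - a₁ * t - a₂ * t ^ 2| ≤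
      C * |t| ^ 3 * (weight l d x + weight l d (x + EuclideanSpace.single i t)))
    (hub : ∀ x, |u x| ≤ C * weight l d x) :
    |(u (x + EuclideanSpace.single i s) + u (x + EuclideanSpace.single i (-s))) / 2 -
      ∫ t, u (x + EuclideanSpace.single i (s * t)) ∂(gaussianReal 0 1)| ≤
      C * (2 + 2 * thirdMomentConst e) * s ^ 3 * weight l d' x := by
  have h1e : 0 < 1 - e := by linarith
  have hls : l * s ^ 2 ≤ l * s ^ 2 / (1 - e) := by
    rw [le_div_iff₀ h1e]; nlinarith [mul_nonneg hl (sq_nonneg s)]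
  have hls0 : 0 ≤ l * s ^ 2 := by positivity
  have hdd : weight l d x ≤ weight l d' x := by
    refine weight_mono hl (fun j => ?_) hlt x
    by_cases hj : j = i
    · subst hj; linarith
    · rw [hne j hj]
  -- the Rademacher side
  have hT : |(u (x + EuclideanSpace.single i s) + u (x + EuclideanSpace.single i (-s))) / 2
      - (u x + a₂ * s ^ 2)| ≤ C * 2 * s ^ 3 * weight l d' x := by
    have h1 := ht s
    have h2 := ht (-s)
    have h3 := mul_le_mul_of_nonneg_left
      (weight_avg_le hl hne (by linarith : d i + l * s ^ 2 ≤ d' i) (hlt i) x)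
      (by positivity : 0 ≤ C * s ^ 3)
    have h4 := mul_le_mul_of_nonneg_left hdd (by positivity : 0 ≤ C * s ^ 3)
    rw [abs_neg, abs_of_nonneg hs] at h2
    rw [abs_of_nonneg hs] at h1
    rw [abs_le] at *
    constructor <;> linarith
  -- the Gaussian side
  have hid : Integrable (fun t : ℝ => t) (gaussianReal 0 1) :=
    (memLp_id_gaussianReal 1).integrable le_rfl
  have hsq : Integrable (fun t : ℝ => t ^ 2) (gaussianReal 0 1) :=
    (memLp_id_gaussianReal 2).integrable_sq
  have hm1 : ∫ t : ℝ, t ∂(gaussianReal 0 1) = 0 := by simp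
  have hm2 : ∫ t : ℝ, t ^ 2 ∂(gaussianReal 0 1) = 1 := by
    have := variance_fun_id_gaussianReal (μ := 0) (v := 1)
    rw [variance_of_integral_eq_zero (by fun_prop) (by simp)] at this
    simpa using this
  have hw := integral_weight_le hl hne (by linarith : d i + l * s ^ 2 ≤ d' i) (hlt i) x
  have hui : Integrable (fun t => u (x + EuclideanSpace.single i (s * t))) (gaussianReal 0 1) :=
    (hw.1.const_mul C).mono' (Continuous.aestronglyMeasurable (by fun_prop))
      (ae_of_all _ fun t => hub _)
  obtain ⟨hc1, hc2⟩ := integral_abs_pow_three_mul_weight_le hl he0 he hne hi (hlt i) x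
  obtain ⟨hc3, hc4⟩ := integral_abs_pow_three_mul_weight_le (s := 0) (d := d') (d' := d')
    (i := i) hl he0 he (fun _ _ => rfl) (by simp) (hlt i) x
  have hz : (EuclideanSpace.single i (0 : ℝ) : EuclideanSpace ℝ (Fin k)) = 0 := by
    ext j; simp
  simp only [zero_mul, hz, add_zero] at hc3 hc4
  have hpoly : ∫ t, (u x + a₁ * (s * t) + a₂ * (s * t) ^ 2) ∂(gaussianReal 0 1) =
      u x + a₂ * s ^ 2 := by
    have h1 : Integrable (fun t : ℝ => u x + a₁ * s * t) (gaussianReal 0 1) :=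
      (integrable_const _).add (hid.const_mul _)
    calc _ = ∫ t, ((u x + a₁ * s * t) + a₂ * s ^ 2 * t ^ 2) ∂(gaussianReal 0 1) := by
          congr 1; ext t; ring
      _ = _ := by
          rw [integral_add h1 (hsq.const_mul _), integral_add (integrable_const _)
            (hid.const_mul _), integral_const_mul, integral_const_mul, hm1, hm2]
          simp
  have hpi : Integrable (fun t => u x + a₁ * (s * t) + a₂ * (s * t) ^ 2) (gaussianReal 0 1) := by
    have h1 : Integrable (fun t : ℝ => (u x + a₁ * s * t) + a₂ * s ^ 2 * t ^ 2)
      (gaussianReal 0 1) := ((integrable_const _).add (hid.const_mul _)).add (hsq.const_mul _)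
    refine h1.congr (ae_of_all _ fun t => ?_)
    ring
  have hG : |∫ t, u (x + EuclideanSpace.single i (s * t)) ∂(gaussianReal 0 1) -
      (u x + a₂ * s ^ 2)| ≤ C * s ^ 3 * (2 * thirdMomentConst e * weight l d' x) := by
    rw [← hpoly, ← integral_sub hui hpi]
    have hb : ∀ t, ‖u (x + EuclideanSpace.single i (s * t)) -
        (u x + a₁ * (s * t) + a₂ * (s * t) ^ 2)‖ ≤ C * s ^ 3 * (|t| ^ 3 * weight l d' x +
          |t| ^ 3 * weight l d (x + EuclideanSpace.single i (s * t))) := by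
      intro t
      have h1 := ht (s * t)
      rw [abs_mul, abs_of_nonneg hs] at h1
      rw [Real.norm_eq_abs]
      calc _ = |u (x + EuclideanSpace.single i (s * t)) - u x - a₁ * (s * t) -
            a₂ * (s * t) ^ 2| := by congr 1; ring
        _ ≤ _ := h1
        _ ≤ C * (s * |t|) ^ 3 * (weight l d' x +
            weight l d (x + EuclideanSpace.single i (s * t))) := by gcongr
        _ = _ := by ring
    refine (norm_integral_le_of_norm_le ((hc3.add hc1).const_mul (C * s ^ 3))
      (ae_of_all _ hb)).trans ?_
    simp only [Pi.add_apply]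
    rw [integral_const_mul, integral_add hc3 hc1]
    gcongr
    linarith
  rw [abs_le] at *
  constructor <;> linarith

/-- The total error of replacing all Rademacher summands by Gaussian ones. -/
theorem abs_rademacherAvg_sub_integral_gaussianSum_le (hl : 0 ≤ l) (he0 : 0 < e) (he : e < 1)
    (hδ : ∀ j, 0 ≤ δ j) {f : EuclideanSpace ℝ (Fin k) → ℝ}
    {f₁ f₂ : Fin k → EuclideanSpace ℝ (Fin k) → ℝ} (hfc : Continuous f) {C : ℝ} (hC : 0 ≤ C)
    (hf : ∀ x, |f x| ≤ C * weight l 0 x)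
    (hft : ∀ i x t, |f (x + EuclideanSpace.single i t) - f x - f₁ i x * t - f₂ i x * t ^ 2| ≤
      C * |t| ^ 3 * (weight l 0 x + weight l 0 (x + EuclideanSpace.single i t)))
    (L : List (Fin k)) (hL : ∀ j, budget (l / (1 - e)) δ L j < 1)
    (x : EuclideanSpace ℝ (Fin k)) :
    |rademacherAvg δ L f x - ∫ y, f (x + y) ∂(gaussianSum δ L)| ≤
      C * (2 + 2 * thirdMomentConst e) * (L.map fun i => √(δ i) ^ 3).sum *
        weight l (budget (l / (1 - e)) δ L) x := by
  induction L generalizing x with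
  | nil => simp [rademacherAvg, gaussianSum]
  | cons i L ih =>
    have hL' := budget_lt_one_of_cons hl he hδ hL
    have ih := ih hL'
    set K := C * (2 + 2 * thirdMomentConst e) * (L.map fun i => √(δ i) ^ 3).sum with hK
    have hK0 : 0 ≤ K := by
      have h1 : 0 ≤ (L.map fun i => √(δ i) ^ 3).sum :=
        List.sum_nonneg (by intro a ha; simp at ha; obtain ⟨j, _, rfl⟩ := ha; positivity)
      have h2 : 0 ≤ thirdMomentConst e := by unfold thirdMomentConst; positivity
      positivity
    have hne : ∀ j, j ≠ i → budget (l / (1 - e)) δ (i :: L) j = budget (l / (1 - e)) δ L j :=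
      fun j => budget_cons_of_ne (l / (1 - e)) δ L
    obtain ⟨hb1, hb2⟩ := budget_step hl he0.le he hδ L i
    have hrb := abs_rademacherAvg_le hl he0.le he hδ hC hf L hL'
    have h1 := abs_avg_sub_integral_le hl he0 he (continuous_rademacherAvg (δ := δ) hfc L) hC
      (Real.sqrt_nonneg (δ i)) hne hb1.le hL x
      (rademacherAvg_taylor hl he0.le he hδ hC i (hft i) L hL' x) hrb
    obtain ⟨hw1, hw2⟩ := integral_weight_le hl hne hb2 (hL i) x
    have hri : Integrable (fun t => rademacherAvg δ L f
        (x + EuclideanSpace.single i (√(δ i) * t))) (gaussianReal 0 1) := by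
      have := continuous_rademacherAvg (δ := δ) hfc L
      exact (hw1.const_mul C).mono' (Continuous.aestronglyMeasurable (by fun_prop))
        (ae_of_all _ fun t => hrb _)
    have hgi : Integrable (fun t => ∫ y, f (x + EuclideanSpace.single i (√(δ i) * t) + y)
        ∂(gaussianSum δ L)) (gaussianReal 0 1) := by
      refine (hw1.const_mul C).mono' ?_
        (ae_of_all _ fun t => abs_integral_gaussianSum_le hl he0.le he hδ hC hf L hL' _)
      apply StronglyMeasurable.aestronglyMeasurable
      apply StronglyMeasurable.integral_prod_right'
        (f := fun p : ℝ × EuclideanSpace ℝ (Fin k) =>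
          f (x + EuclideanSpace.single i (√(δ i) * p.1) + p.2))
      exact Continuous.stronglyMeasurable (by fun_prop)
    have h2 : |∫ t, rademacherAvg δ L f (x + EuclideanSpace.single i (√(δ i) * t))
          ∂(gaussianReal 0 1) - ∫ y, f (x + y) ∂(gaussianSum δ (i :: L))| ≤
        K * weight l (budget (l / (1 - e)) δ (i :: L)) x := by
      rw [integral_gaussianSum_cons hfc
        (integrable_gaussianSum hl he0.le he hδ hfc hf (i :: L) hL x), ← integral_sub hri hgi]
      refine (norm_integral_le_of_norm_le
        (f := fun t => rademacherAvg δ L f (x + EuclideanSpace.single i (√(δ i) * t)) -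
          ∫ y, f (x + EuclideanSpace.single i (√(δ i) * t) + y) ∂(gaussianSum δ L))
        (hw1.const_mul K) (ae_of_all _ fun t => ih _)).trans ?_
      rw [integral_const_mul]
      gcongr
    simp only [rademacherAvg, List.map_cons, List.sum_cons]
    rw [mul_add, add_mul, ← hK]
    rw [abs_le] at *
    constructor <;> linarith

end Lindeberg

lemma charFun_map_single (i : Fin k) (s : ℝ) (t : EuclideanSpace ℝ (Fin k)) :
    charFun ((gaussianReal 0 1).map fun u => (EuclideanSpace.single i (s * u) :
      EuclideanSpace ℝ (Fin k))) t = Complex.exp (-((s ^ 2 * t i ^ 2 / 2 : ℝ) : ℂ)) := by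
  rw [charFun_apply, integral_map (Continuous.aemeasurable (by fun_prop))
    (Continuous.aestronglyMeasurable (by fun_prop))]
  have h := charFun_gaussianReal (μ := 0) (v := 1) (s * t i)
  rw [charFun_apply_real] at h
  convert h using 2
  · ext u
    congr 2
    rw [EuclideanSpace.inner_single_left]
    simp
    ring
  · push_cast; simp; ring

lemma charFun_gaussianSum {δ : Fin k → ℝ} (hδ : ∀ j, 0 ≤ δ j) (L : List (Fin k))
    (t : EuclideanSpace ℝ (Fin k)) :
    charFun (gaussianSum δ L) t =
      Complex.exp (-((∑ j, δ j * L.count j * t j ^ 2 / 2 : ℝ) : ℂ)) := by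
  induction L with
  | nil => simp [gaussianSum]
  | cons i L ih =>
    rw [gaussianSum, charFun_conv, ih, charFun_map_single, ← Complex.exp_add, ← neg_add,
      ← Complex.ofReal_add]
    congr 3
    rw [Real.sq_sqrt (hδ i)]
    have h : ∀ j, δ j * ((i :: L).count j : ℝ) * t j ^ 2 / 2 =
        (if j = i then δ i * t i ^ 2 / 2 else 0) + δ j * (L.count j : ℝ) * t j ^ 2 / 2 := by
      intro j
      by_cases hj : j = i
      · subst hj; simp; ring
      · simp [hj, List.count_cons_of_ne (Ne.symm hj)]
    simp only [h, Finset.sum_add_distrib]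
    simp

lemma gaussianSum_eq_stdGaussian {δ : Fin k → ℝ} (hδ : ∀ j, 0 ≤ δ j) (L : List (Fin k))
    (h : ∀ j, δ j * L.count j = 1) :
    gaussianSum δ L = stdGaussian (EuclideanSpace ℝ (Fin k)) := by
  refine Measure.ext_of_charFun (funext fun t => ?_)
  rw [charFun_gaussianSum hδ, charFun_stdGaussian]
  simp only [h, one_mul, ← Finset.sum_div]
  rw [← EuclideanSpace.real_norm_sq_eq]
  push_cast
  rw [neg_div]

lemma rademacherAvg_ofFn (δ : Fin k → ℝ) {N : ℕ} (b : Fin N → Fin k)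
    (f : EuclideanSpace ℝ (Fin k) → ℝ) (x : EuclideanSpace ℝ (Fin k)) :
    rademacherAvg δ (List.ofFn b) f x = (∑ ε : Config N,
      f (x + ∑ v, EuclideanSpace.single (b v) (√(δ (b v)) * spin ε v))) / 2 ^ N := by
  induction N generalizing x with
  | zero => simp [rademacherAvg]
  | succ N ih =>
    rw [List.ofFn_succ, rademacherAvg, ih, ih,
      ← (Fin.consEquiv fun _ : Fin (N + 1) => ℤˣ).sum_comp, Fintype.sum_prod_type]
    have hs : ∀ (a : ℤˣ) (ε : Config N), f (x + ∑ v : Fin (N + 1), EuclideanSpace.single (b v)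
        (√(δ (b v)) * spin ((Fin.consEquiv fun _ : Fin (N + 1) => ℤˣ) (a, ε)) v)) =
        f (x + EuclideanSpace.single (b 0) (√(δ (b 0)) * ((a : ℤ) : ℝ)) +
          ∑ v : Fin N, EuclideanSpace.single (b v.succ) (√(δ (b v.succ)) * spin ε v)) := by
      intro a ε
      rw [Fin.sum_univ_succ, ← add_assoc]
      simp [spin, Fin.consEquiv]
    simp only [hs]
    have hu : (Finset.univ : Finset ℤˣ) = {1, -1} := rfl
    rw [hu, Finset.sum_pair (by decide)]
    simp
    ring

lemma count_ofFn {N : ℕ} (b : Fin N → Fin k) (j : Fin k) :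
    (List.ofFn b).count j = (block b j).card := by
  induction N with
  | zero => simp [block]
  | succ N ih =>
    rw [List.ofFn_succ, List.count_cons, ih, block, block, Fin.card_filter_univ_succ]
    by_cases h : b 0 = j
    · simp [h, add_comm]
    · simp [h]

lemma sum_block {N : ℕ} (b : Fin N → Fin k) (g : Fin k → ℝ) :
    ∑ v, g (b v) = ∑ j, ((block b j).card : ℝ) * g j := by
  rw [← Finset.sum_fiberwise (s := Finset.univ) (g := b)]
  refine Finset.sum_congr rfl fun j _ => ?_
  rw [Finset.sum_congr rfl (g := fun _ => g j)]
  · simp [block]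
  · intro v hv; simp at hv; rw [hv]

lemma magnetization_eq_sum {N : ℕ} (b : Fin N → Fin k) (ε : Config N) :
    magnetization b ε = ∑ v, EuclideanSpace.single (b v)
      (√(((block b (b v)).card : ℝ)⁻¹) * spin ε v) := by
  ext j
  rw [WithLp.ofLp_sum, Finset.sum_apply]
  simp only [magnetization, block, Finset.sum_filter, Finset.sum_div]
  refine Finset.sum_congr rfl fun v _ => ?_
  by_cases h : b v = j
  · subst h; simp; ring
  · simp [h, Ne.symm h]

/-- Gaussian approximation of the normalized block sums of independent uniform spins. -/
theorem abs_avg_magnetization_sub_integral_le {l e : ℝ} (hl : 0 ≤ l) (he0 : 0 < e) (he : e < 1)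
    (hle : l / (1 - e) < 1) {f : EuclideanSpace ℝ (Fin k) → ℝ}
    {f₁ f₂ : Fin k → EuclideanSpace ℝ (Fin k) → ℝ} (hfc : Continuous f) {C : ℝ} (hC : 0 ≤ C)
    (hf : ∀ x, |f x| ≤ C * weight l 0 x)
    (hft : ∀ i x t, |f (x + EuclideanSpace.single i t) - f x - f₁ i x * t - f₂ i x * t ^ 2| ≤
      C * |t| ^ 3 * (weight l 0 x + weight l 0 (x + EuclideanSpace.single i t)))
    {N : ℕ} (b : Fin N → Fin k) (hb : ∀ j, 0 < (block b j).card) :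
    Integrable f (stdGaussian (EuclideanSpace ℝ (Fin k))) ∧
    |∫ y, f y ∂(stdGaussian (EuclideanSpace ℝ (Fin k)))| ≤ C * ((√(1 - l / (1 - e)))⁻¹) ^ k ∧
    |(∑ ε : Config N, f (magnetization b ε)) / 2 ^ N -
        ∫ y, f y ∂(stdGaussian (EuclideanSpace ℝ (Fin k)))| ≤
      C * (2 + 2 * thirdMomentConst e) * (∑ j, (√((block b j).card : ℝ))⁻¹) *
        ((√(1 - l / (1 - e)))⁻¹) ^ k := by
  set δ : Fin k → ℝ := fun j => ((block b j).card : ℝ)⁻¹ with hδ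
  have hδ0 : ∀ j, 0 ≤ δ j := fun j => by positivity
  have hc : ∀ j, δ j * (List.ofFn b).count j = 1 := by
    intro j
    rw [count_ofFn, hδ]
    have : ((block b j).card : ℝ) ≠ 0 := by exact_mod_cast (hb j).ne'
    field_simp
  have hbud : budget (l / (1 - e)) δ (List.ofFn b) = fun _ => l / (1 - e) := by
    ext j; rw [budget, mul_assoc, hc, mul_one]
  have hL : ∀ j, budget (l / (1 - e)) δ (List.ofFn b) j < 1 := by
    intro j; rw [hbud]; exact hle
  have hw : weight l (budget (l / (1 - e)) δ (List.ofFn b)) 0 =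
      ((√(1 - l / (1 - e)))⁻¹) ^ k := by
    rw [hbud]; simp [weight, gaussWeight]
  have hstd := gaussianSum_eq_stdGaussian hδ0 (List.ofFn b) hc
  have h1 := integrable_gaussianSum hl he0.le he hδ0 hfc hf _ hL 0
  have h2 := abs_integral_gaussianSum_le hl he0.le he hδ0 hC hf _ hL 0
  have h3 := abs_rademacherAvg_sub_integral_gaussianSum_le hl he0 he hδ0 hfc hC hf hft _ hL 0
  rw [hw, hstd] at h2 h3
  rw [hstd] at h1
  simp only [zero_add] at h1 h2 h3
  refine ⟨h1, h2, ?_⟩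
  convert h3 using 3
  · rw [rademacherAvg_ofFn]
    simp only [zero_add, magnetization_eq_sum, hδ]
  · rw [List.map_ofFn, List.sum_ofFn]
    simp only [Function.comp_apply]
    rw [sum_block b (fun j => √(δ j) ^ 3)]
    refine Finset.sum_congr rfl fun j _ => ?_
    have h0 : (0 : ℝ) < (block b j).card := by exact_mod_cast hb j
    have h4 : 0 < √((block b j).card : ℝ) := Real.sqrt_pos.2 h0
    rw [hδ]
    simp only [Real.sqrt_inv]
    nth_rewrite 2 [← Real.sq_sqrt h0.le]
    field_simp

/-! ### Test functions times the exponential of a quadratic form -/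

lemma abs_taylor_two_le {φ φ₁ φ₂ φ₃ : ℝ → ℝ} (h0 : ∀ s, HasDerivAt φ (φ₁ s) s)
    (h1 : ∀ s, HasDerivAt φ₁ (φ₂ s) s) (h2 : ∀ s, HasDerivAt φ₂ (φ₃ s) s) {t M : ℝ}
    (hM : ∀ s ∈ Set.uIcc 0 t, |φ₃ s| ≤ M) :
    |φ t - φ 0 - φ₁ 0 * t - φ₂ 0 / 2 * t ^ 2| ≤ M * |t| ^ 3 := by
  have hM0 : 0 ≤ M := (abs_nonneg _).trans (hM 0 Set.left_mem_uIcc)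
  have hst : ∀ s ∈ Set.uIcc 0 t, |s| ≤ |t| := fun s hs => by
    simpa using Set.abs_sub_left_of_mem_uIcc hs
  have a1 : ∀ s ∈ Set.uIcc 0 t, |φ₂ s - φ₂ 0| ≤ M * |t| := by
    intro s hs
    have := Convex.norm_image_sub_le_of_norm_hasDerivWithin_le
      (fun x _ => (h2 x).hasDerivWithinAt) hM (convex_uIcc 0 t) Set.left_mem_uIcc hs
    rw [Real.norm_eq_abs, Real.norm_eq_abs, sub_zero] at this
    exact this.trans (mul_le_mul_of_nonneg_left (hst s hs) hM0)
  have a2 : ∀ s ∈ Set.uIcc 0 t, |φ₁ s - φ₁ 0 - φ₂ 0 * s| ≤ M * |t| ^ 2 := by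
    intro s hs
    have hd : ∀ x, HasDerivAt (fun s => φ₁ s - φ₂ 0 * s) (φ₂ x - φ₂ 0) x := fun x =>
      ((h1 x).sub ((hasDerivAt_id x).const_mul (φ₂ 0))).congr_deriv (by simp)
    have := Convex.norm_image_sub_le_of_norm_hasDerivWithin_le
      (fun x _ => (hd x).hasDerivWithinAt) a1 (convex_uIcc 0 t) Set.left_mem_uIcc hs
    rw [Real.norm_eq_abs, Real.norm_eq_abs, sub_zero] at this
    calc _ = |φ₁ s - φ₂ 0 * s - (φ₁ 0 - φ₂ 0 * 0)| := by congr 1; ring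
      _ ≤ _ := this
      _ ≤ M * |t| * |t| := mul_le_mul_of_nonneg_left (hst s hs) (by positivity)
      _ = _ := by ring
  have hd : ∀ x, HasDerivAt (fun s => φ s - φ₁ 0 * s - φ₂ 0 / 2 * s ^ 2)
      (φ₁ x - φ₁ 0 - φ₂ 0 * x) x := fun x => by
    have := ((h0 x).sub ((hasDerivAt_id x).const_mul (φ₁ 0))).sub
      ((hasDerivAt_pow 2 x).const_mul (φ₂ 0 / 2))
    refine this.congr_deriv ?_
    simp; ring
  have := Convex.norm_image_sub_le_of_norm_hasDerivWithin_le
    (fun x _ => (hd x).hasDerivWithinAt) a2 (convex_uIcc 0 t) Set.left_mem_uIcc Set.right_mem_uIcc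
  rw [Real.norm_eq_abs, Real.norm_eq_abs, sub_zero] at this
  calc _ = |φ t - φ₁ 0 * t - φ₂ 0 / 2 * t ^ 2 - (φ 0 - φ₁ 0 * 0 - φ₂ 0 / 2 * 0 ^ 2)| := by
        congr 1; ring
    _ ≤ _ := this
    _ = _ := by ring

/-- The functions with three iterated derivatives in each coordinate direction such that the
function and these derivatives grow at most quadratically. -/
structure TestFunction (C : ℝ) (g : EuclideanSpace ℝ (Fin k) → ℝ)
    (g₁ g₂ g₃ : Fin k → EuclideanSpace ℝ (Fin k) → ℝ) : Prop where
  continuous : Continuous g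
  hasDerivAt₀ : ∀ i x t, HasDerivAt (fun s : ℝ => g (x + EuclideanSpace.single i s))
    (g₁ i (x + EuclideanSpace.single i t)) t
  hasDerivAt₁ : ∀ i x t, HasDerivAt (fun s : ℝ => g₁ i (x + EuclideanSpace.single i s))
    (g₂ i (x + EuclideanSpace.single i t)) t
  hasDerivAt₂ : ∀ i x t, HasDerivAt (fun s : ℝ => g₂ i (x + EuclideanSpace.single i s))
    (g₃ i (x + EuclideanSpace.single i t)) t
  bound₀ : ∀ x, |g x| ≤ C * (1 + ‖x‖) ^ 2
  bound₁ : ∀ i x, |g₁ i x| ≤ C * (1 + ‖x‖) ^ 2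
  bound₂ : ∀ i x, |g₂ i x| ≤ C * (1 + ‖x‖) ^ 2
  bound₃ : ∀ i x, |g₃ i x| ≤ C * (1 + ‖x‖) ^ 2

/-- Half the quadratic form of `T`. -/
noncomputable def halfForm (T : EuclideanSpace ℝ (Fin k) →L[ℝ] EuclideanSpace ℝ (Fin k))
    (x : EuclideanSpace ℝ (Fin k)) : ℝ := inner ℝ (T x) x / 2

@[fun_prop]
lemma continuous_halfForm (T : EuclideanSpace ℝ (Fin k) →L[ℝ] EuclideanSpace ℝ (Fin k)) :
    Continuous (halfForm T) := by
  unfold halfForm; fun_prop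

lemma hasDerivAt_single (x : EuclideanSpace ℝ (Fin k)) (i : Fin k) (t : ℝ) :
    HasDerivAt (fun s : ℝ => x + EuclideanSpace.single i s)
      (EuclideanSpace.single i (1 : ℝ)) t := by
  have h : (fun s : ℝ => x + (EuclideanSpace.single i s : EuclideanSpace ℝ (Fin k))) =
      fun s => x + s • EuclideanSpace.single i (1 : ℝ) := by
    ext t j; simp
  rw [h]
  simpa using ((hasDerivAt_id t).smul_const (EuclideanSpace.single i (1 : ℝ))).const_add x

section Tilt

variable {T : EuclideanSpace ℝ (Fin k) →L[ℝ] EuclideanSpace ℝ (Fin k)}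

lemma hasDerivAt_apply_single (x : EuclideanSpace ℝ (Fin k)) (i : Fin k) (t : ℝ) :
    HasDerivAt (fun s : ℝ => T (x + EuclideanSpace.single i s) i)
      (T (EuclideanSpace.single i 1) i) t := by
  have h := (T.hasFDerivAt (x := x + EuclideanSpace.single i t)).comp_hasDerivAt t
    (hasDerivAt_single x i t)
  exact (EuclideanSpace.proj (𝕜 := ℝ) i).hasFDerivAt.comp_hasDerivAt t h

lemma hasDerivAt_exp_halfForm (hT : ∀ x y, inner ℝ (T x) y = inner ℝ x (T y))
    (x : EuclideanSpace ℝ (Fin k)) (i : Fin k) (t : ℝ) :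
    HasDerivAt (fun s : ℝ => Real.exp (halfForm T (x + EuclideanSpace.single i s)))
      (Real.exp (halfForm T (x + EuclideanSpace.single i t)) *
        T (x + EuclideanSpace.single i t) i) t := by
  apply HasDerivAt.exp
  have h := (T.hasFDerivAt (x := x + EuclideanSpace.single i t)).comp_hasDerivAt t
    (hasDerivAt_single x i t)
  have h2 := (h.inner ℝ (hasDerivAt_single x i t)).div_const 2
  refine h2.congr_deriv ?_
  rw [hT (EuclideanSpace.single i 1), real_inner_comm]
  simp only [Function.comp_apply, EuclideanSpace.inner_single_left]
  simp

lemma exists_pow_five_le_exp {a : ℝ} (ha : 0 < a) :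
    ∃ K, 0 ≤ K ∧ ∀ s : ℝ, 0 ≤ s → (1 + s) ^ 5 ≤ K * Real.exp (a * s ^ 2 / 2) := by
  refine ⟨8 * (48 / a ^ 3) * Real.exp (a / 2), by positivity, fun s hs => ?_⟩
  have h1 : (1 + s) ^ 5 ≤ (1 + s) ^ 6 := pow_le_pow_right₀ (by linarith) (by norm_num)
  have h2 : (1 + s) ^ 2 ≤ 2 * (1 + s ^ 2) := by nlinarith [sq_nonneg (s - 1)]
  have h3 : (1 + s) ^ 6 ≤ 8 * (1 + s ^ 2) ^ 3 := by
    calc (1 + s) ^ 6 = ((1 + s) ^ 2) ^ 3 := by ring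
      _ ≤ (2 * (1 + s ^ 2)) ^ 3 := by gcongr
      _ = _ := by ring
  have h4 := Real.pow_div_factorial_le_exp (a * (1 + s ^ 2) / 2) (by positivity) 3
  have h5 : (1 + s ^ 2) ^ 3 = 48 / a ^ 3 * ((a * (1 + s ^ 2) / 2) ^ 3 / (Nat.factorial 3 : ℝ)) := by
    simp [Nat.factorial]; field_simp; norm_num
  calc (1 + s) ^ 5 ≤ 8 * (1 + s ^ 2) ^ 3 := h1.trans h3
    _ ≤ 8 * (48 / a ^ 3 * Real.exp (a * (1 + s ^ 2) / 2)) := by rw [h5]; gcongr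
    _ = _ := by
      rw [show a * (1 + s ^ 2) / 2 = a / 2 + a * s ^ 2 / 2 by ring, Real.exp_add]; ring

lemma norm_add_single_le_max (x : EuclideanSpace ℝ (Fin k)) (i : Fin k) {s t : ℝ}
    (hs : s ∈ Set.uIcc 0 t) : ‖x + EuclideanSpace.single i s‖ ≤
      max ‖x‖ ‖x + EuclideanSpace.single i t‖ := by
  have hc : ConvexOn ℝ Set.univ (fun s : ℝ => ‖x + EuclideanSpace.single i s‖) := by
    have h : (fun s : ℝ => ‖x + (EuclideanSpace.single i s : EuclideanSpace ℝ (Fin k))‖) =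
        norm ∘ (AffineMap.lineMap x (x + EuclideanSpace.single i (1 : ℝ)) :
          ℝ →ᵃ[ℝ] EuclideanSpace ℝ (Fin k)) := by
      funext s
      simp only [Function.comp_apply, AffineMap.lineMap_apply]
      congr 1
      ext j; simp; ring
    rw [h]
    exact (convexOn_univ_norm).comp_affineMap _
  have := hc.le_max_of_mem_segment (Set.mem_univ 0) (Set.mem_univ t)
    (by rwa [segment_eq_uIcc])
  have hz : (EuclideanSpace.single i (0 : ℝ) : EuclideanSpace ℝ (Fin k)) = 0 := by
    ext j; simp
  simpa [hz] using this

/-- The hypotheses of the Gaussian approximation hold for a test function times the exponential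
of half a quadratic form of norm less than `1`. -/
lemma exists_tilt_bounds {l₀ l : ℝ} (hl₀ : l₀ < l) (hl1 : l₀ < 1) :
    ∃ K : ℝ, 0 ≤ K ∧ ∀ (T : EuclideanSpace ℝ (Fin k) →L[ℝ] EuclideanSpace ℝ (Fin k)),
      (∀ x y, inner ℝ (T x) y = inner ℝ x (T y)) → ‖T‖ ≤ l₀ →
      ∀ C g g₁ g₂ g₃, 0 ≤ C → TestFunction C g g₁ g₂ g₃ →
      (∀ x, |g x * Real.exp (halfForm T x)| ≤ K * C * weight l 0 x) ∧
      ∃ f₁ f₂ : Fin k → EuclideanSpace ℝ (Fin k) → ℝ, ∀ i x t,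
        |g (x + EuclideanSpace.single i t) * Real.exp (halfForm T (x + EuclideanSpace.single i t)) -
          g x * Real.exp (halfForm T x) - f₁ i x * t - f₂ i x * t ^ 2| ≤
        K * C * |t| ^ 3 * (weight l 0 x + weight l 0 (x + EuclideanSpace.single i t)) := by
  obtain ⟨K, hK0, hK⟩ := exists_pow_five_le_exp (a := l - l₀) (by linarith)
  refine ⟨14 * K, by positivity, fun T hT hTn C g g₁ g₂ g₃ hC hg => ?_⟩
  have hexp : ∀ x, (1 + ‖x‖) ^ 5 * Real.exp (halfForm T x) ≤ K * weight l 0 x := by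
    intro x
    have h1 : halfForm T x ≤ l₀ * ‖x‖ ^ 2 / 2 := by
      unfold halfForm
      have h2 := real_inner_le_norm (T x) x
      have h3 := (T.le_opNorm x).trans (mul_le_mul_of_nonneg_right hTn (norm_nonneg x))
      have h4 := mul_le_mul_of_nonneg_right h3 (norm_nonneg x)
      linarith
    rw [weight_zero_eq]
    calc (1 + ‖x‖) ^ 5 * Real.exp (halfForm T x) ≤
          (K * Real.exp ((l - l₀) * ‖x‖ ^ 2 / 2)) * Real.exp (l₀ * ‖x‖ ^ 2 / 2) := by
          gcongr; exact hK _ (norm_nonneg x)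
      _ = _ := by rw [mul_assoc, ← Real.exp_add]; congr 2; ring
  have hp : ∀ x i, |T x i| ≤ 1 + ‖x‖ := by
    intro x i
    have h1 := PiLp.norm_apply_le (T x) i
    have h3 := (T.le_opNorm x).trans (mul_le_mul_of_nonneg_right hTn (norm_nonneg x))
    rw [Real.norm_eq_abs] at h1
    nlinarith [norm_nonneg x]
  have hc : ∀ i, |T (EuclideanSpace.single i 1) i| ≤ 1 := by
    intro i
    have h1 := PiLp.norm_apply_le (T (EuclideanSpace.single i 1)) i
    have h3 := (T.le_opNorm (EuclideanSpace.single i 1)).trans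
      (mul_le_mul_of_nonneg_right hTn (norm_nonneg _))
    rw [Real.norm_eq_abs] at h1
    simp at h3
    linarith
  constructor
  · intro x
    rw [abs_mul, Real.abs_exp]
    have h5 : (1 + ‖x‖) ^ 2 ≤ (1 + ‖x‖) ^ 5 :=
      pow_le_pow_right₀ (by linarith [norm_nonneg x]) (by norm_num)
    have hw := weight_nonneg l 0 x
    calc |g x| * Real.exp (halfForm T x) ≤ C * (1 + ‖x‖) ^ 5 * Real.exp (halfForm T x) := by
          gcongr; exact (hg.bound₀ x).trans (by gcongr)
      _ = C * ((1 + ‖x‖) ^ 5 * Real.exp (halfForm T x)) := by ring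
      _ ≤ C * (K * weight l 0 x) := mul_le_mul_of_nonneg_left (hexp x) hC
      _ ≤ 14 * K * C * weight l 0 x := by
          have : 0 ≤ K * C * weight l 0 x := by positivity
          linarith
  · set c : Fin k → ℝ := fun i => T (EuclideanSpace.single i 1) i with hcdef
    set f₁ : Fin k → EuclideanSpace ℝ (Fin k) → ℝ := fun i x =>
      (g₁ i x + g x * T x i) * Real.exp (halfForm T x) with hf₁
    set f₂ : Fin k → EuclideanSpace ℝ (Fin k) → ℝ := fun i x =>
      (g₂ i x + 2 * (g₁ i x * T x i) + g x * (T x i ^ 2 + c i)) * Real.exp (halfForm T x) with hf₂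
    set f₃ : Fin k → EuclideanSpace ℝ (Fin k) → ℝ := fun i x =>
      (g₃ i x + 3 * (g₂ i x * T x i) + 3 * (g₁ i x * (T x i ^ 2 + c i)) +
        g x * (T x i ^ 3 + 3 * (T x i * c i))) * Real.exp (halfForm T x) with hf₃
    refine ⟨f₁, fun i x => f₂ i x / 2, fun i x t => ?_⟩
    have hE := hasDerivAt_exp_halfForm hT x i
    have hP := hasDerivAt_apply_single (T := T) x i
    have d0 : ∀ s, HasDerivAt (fun s : ℝ => g (x + EuclideanSpace.single i s) *
        Real.exp (halfForm T (x + EuclideanSpace.single i s)))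
        (f₁ i (x + EuclideanSpace.single i s)) s := fun s => by
      refine ((hg.hasDerivAt₀ i x s).mul (hE s)).congr_deriv ?_
      simp only [hf₁]; ring
    have d1 : ∀ s, HasDerivAt (fun s : ℝ => f₁ i (x + EuclideanSpace.single i s))
        (f₂ i (x + EuclideanSpace.single i s)) s := fun s => by
      refine (((hg.hasDerivAt₁ i x s).add ((hg.hasDerivAt₀ i x s).mul (hP s))).mul
        (hE s)).congr_deriv ?_
      simp only [hf₂, hcdef, Pi.add_apply, Pi.mul_apply]; ring
    have d2 : ∀ s, HasDerivAt (fun s : ℝ => f₂ i (x + EuclideanSpace.single i s))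
        (f₃ i (x + EuclideanSpace.single i s)) s := fun s => by
      refine ((((hg.hasDerivAt₂ i x s).add (((hg.hasDerivAt₁ i x s).mul (hP s)).const_mul 2)).add
        ((hg.hasDerivAt₀ i x s).mul (((hP s).pow 2).add_const (c i)))).mul (hE s)).congr_deriv ?_
      simp only [hf₃, hcdef, Pi.add_apply, Pi.mul_apply, Pi.pow_apply]; ring
    have hb3 : ∀ y, |f₃ i y| ≤ 14 * K * C * weight l 0 y := by
      intro y
      have hr : 1 ≤ 1 + ‖y‖ := by linarith [norm_nonneg y]
      set r := 1 + ‖y‖ with hrdef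
      have hp1 := hp y i
      have hp2 : |T y i ^ 2 + c i| ≤ 2 * r ^ 2 := by
        refine (abs_add_le _ _).trans ?_
        rw [abs_pow]
        have : |T y i| ^ 2 ≤ r ^ 2 := by gcongr
        have := hc i
        have : 1 ≤ r ^ 2 := one_le_pow₀ hr
        linarith
      have hp3 : |T y i ^ 3 + 3 * (T y i * c i)| ≤ 4 * r ^ 3 := by
        refine (abs_add_le _ _).trans ?_
        rw [abs_pow, abs_mul, abs_mul]
        have h1 : |T y i| ^ 3 ≤ r ^ 3 := by gcongr
        have h2 : |T y i| * |c i| ≤ r * 1 := mul_le_mul hp1 (hc i) (abs_nonneg _) (by linarith)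
        have h3 : r ≤ r ^ 3 := le_self_pow₀ hr (by norm_num)
        norm_num
        linarith
      have hq : |g₃ i y + 3 * (g₂ i y * T y i) + 3 * (g₁ i y * (T y i ^ 2 + c i)) +
          g y * (T y i ^ 3 + 3 * (T y i * c i))| ≤ 14 * C * r ^ 5 := by
        have e1 := hg.bound₃ i y
        have e2 : |g₂ i y * T y i| ≤ C * r ^ 2 * r := by
          rw [abs_mul]; exact mul_le_mul (hg.bound₂ i y) hp1 (abs_nonneg _) (by positivity)
        have e3 : |g₁ i y * (T y i ^ 2 + c i)| ≤ C * r ^ 2 * (2 * r ^ 2) := by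
          rw [abs_mul]; exact mul_le_mul (hg.bound₁ i y) hp2 (abs_nonneg _) (by positivity)
        have e4 : |g y * (T y i ^ 3 + 3 * (T y i * c i))| ≤ C * r ^ 2 * (4 * r ^ 3) := by
          rw [abs_mul]; exact mul_le_mul (hg.bound₀ y) hp3 (abs_nonneg _) (by positivity)
        have p2 : C * r ^ 2 ≤ C * r ^ 5 :=
          mul_le_mul_of_nonneg_left (pow_le_pow_right₀ hr (by norm_num)) hC
        have p3 : C * r ^ 3 ≤ C * r ^ 5 :=
          mul_le_mul_of_nonneg_left (pow_le_pow_right₀ hr (by norm_num)) hC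
        have p4 : C * r ^ 4 ≤ C * r ^ 5 :=
          mul_le_mul_of_nonneg_left (pow_le_pow_right₀ hr (by norm_num)) hC
        rw [← hrdef] at e1
        have q2 : C * r ^ 2 * r = C * r ^ 3 := by ring
        have q3 : C * r ^ 2 * (2 * r ^ 2) = 2 * (C * r ^ 4) := by ring
        have q4 : C * r ^ 2 * (4 * r ^ 3) = 4 * (C * r ^ 5) := by ring
        rw [q2] at e2; rw [q3] at e3; rw [q4] at e4
        rw [abs_le] at *
        constructor <;> linarith
      simp only [hf₃]
      rw [abs_mul, Real.abs_exp]
      calc _ ≤ 14 * C * r ^ 5 * Real.exp (halfForm T y) := by gcongr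
        _ = 14 * C * (r ^ 5 * Real.exp (halfForm T y)) := by ring
        _ ≤ 14 * C * (K * weight l 0 y) :=
          mul_le_mul_of_nonneg_left (hexp y) (by positivity)
        _ = _ := by ring
    have hl0 : 0 ≤ l := by linarith [(norm_nonneg T).trans hTn]
    have := abs_taylor_two_le d0 d1 d2 (t := t)
      (M := 14 * K * C * (weight l 0 x + weight l 0 (x + EuclideanSpace.single i t))) (by
        intro s hs
        refine (hb3 _).trans ?_
        gcongr
        have hn := norm_add_single_le_max x i hs
        rw [weight_zero_eq, weight_zero_eq, weight_zero_eq]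
        rcases le_max_iff.1 hn with h | h
        · refine le_trans ?_ (le_add_of_nonneg_right (Real.exp_nonneg _))
          gcongr
        · refine le_trans ?_ (le_add_of_nonneg_left (Real.exp_nonneg _))
          gcongr)
    have hz : (EuclideanSpace.single i (0 : ℝ) : EuclideanSpace ℝ (Fin k)) = 0 := by
      ext j; simp
    simp only [hz, add_zero] at this
    refine this.trans (le_of_eq ?_)
    ring

end Tilt

/-! ### Tilting the standard Gaussian measure -/

section Density

variable {V : Type*} [NormedAddCommGroup V] [InnerProductSpace ℝ V] [FiniteDimensional ℝ V]
  [MeasurableSpace V] [BorelSpace V]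

lemma integrable_exp_neg_norm_sq_div_two :
    Integrable (fun x : V => Real.exp (-‖x‖ ^ 2 / 2)) := by
  have h := (GaussianFourier.integrable_cexp_neg_mul_sq_norm_add (V := V) (b := 1 / 2)
    (by norm_num) 0 0).norm
  refine h.congr (ae_of_all _ fun x => ?_)
  simp only [Complex.norm_exp]
  congr 1
  rw [show (-(1 / 2 : ℂ) * (‖x‖ : ℂ) ^ 2 + 0 * ((inner ℝ (0 : V) x : ℝ) : ℂ)) =
    ((-‖x‖ ^ 2 / 2 : ℝ) : ℂ) by push_cast; ring, Complex.ofReal_re]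

/-- The standard Gaussian measure has density proportional to `exp (-‖x‖² / 2)`. -/
lemma stdGaussian_eq_withDensity :
    stdGaussian V = volume.withDensity (fun x =>
      ENNReal.ofReal ((∫ y : V, Real.exp (-‖y‖ ^ 2 / 2))⁻¹ * Real.exp (-‖x‖ ^ 2 / 2))) := by
  set I₀ := ∫ y : V, Real.exp (-‖y‖ ^ 2 / 2) with hI
  have hpos : 0 < I₀ := integral_exp_pos integrable_exp_neg_norm_sq_div_two
  have h_integrable : Integrable (fun x : V => I₀⁻¹ * Real.exp (-‖x‖ ^ 2 / 2)) :=
    integrable_exp_neg_norm_sq_div_two.const_mul _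
  have hfin : IsFiniteMeasure (volume.withDensity (fun x : V =>
      ENNReal.ofReal (I₀⁻¹ * Real.exp (-‖x‖ ^ 2 / 2)))) :=
    isFiniteMeasure_withDensity_ofReal h_integrable.2
  refine Measure.ext_of_charFun (funext fun t => ?_)
  rw [charFun_stdGaussian, charFun_apply, integral_withDensity_eq_integral_toReal_smul
    (by fun_prop) (ae_of_all _ fun x => ENNReal.ofReal_lt_top)]
  have hF := fun w : V => GaussianFourier.integral_cexp_neg_mul_sq_norm_add (V := V) (b := 1 / 2)
    (by norm_num) Complex.I w
  have hA : ((I₀ : ℝ) : ℂ) = (Real.pi / (1 / 2) : ℂ) ^ (Module.finrank ℝ V / 2 : ℂ) := by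
    have h0 := hF 0
    simp only [inner_zero_left, norm_zero] at h0
    norm_num at h0
    norm_num
    rw [← h0, hI, ← integral_complex_ofReal]
    congr 1; ext x; push_cast; congr 1; ring
  have h1 : ∀ x : V, (ENNReal.ofReal (I₀⁻¹ * Real.exp (-‖x‖ ^ 2 / 2))).toReal •
      Complex.exp ((inner ℝ x t : ℝ) * Complex.I) = (I₀ : ℂ)⁻¹ *
        Complex.exp (-(1 / 2) * (‖x‖ : ℂ) ^ 2 + Complex.I * (inner ℝ t x : ℝ)) := by
    intro x
    rw [ENNReal.toReal_ofReal (by positivity), Complex.real_smul, Complex.exp_add,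
      real_inner_comm]
    push_cast
    rw [mul_assoc]
    congr 3
    · ring
    · ring
  simp only [h1]
  rw [integral_const_mul, hF, ← hA, ← mul_assoc, inv_mul_cancel₀ (by exact_mod_cast hpos.ne'),
    one_mul]
  congr 1
  rw [Complex.I_sq]
  ring

/-- Tilting the standard Gaussian measure by the exponential of half the quadratic form of `T`
is, up to a constant, the same as mapping it by a linear map `S` with
`‖S y‖² - ⟪T (S y), S y⟫ = ‖y‖²`. -/
lemma exists_integral_tilt_eq (T S : V →L[ℝ] V)
    (hS : ∀ y, ‖S y‖ ^ 2 - inner ℝ (T (S y)) (S y) = ‖y‖ ^ 2) :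
    ∃ z : ℝ, ∀ g : V → ℝ, ∫ x, g x * Real.exp (inner ℝ (T x) x / 2) ∂(stdGaussian V) =
      z * ∫ y, g (S y) ∂(stdGaussian V) := by
  have hinj : Function.Injective (S : V →ₗ[ℝ] V) := by
    rw [← LinearMap.ker_eq_bot, LinearMap.ker_eq_bot']
    intro y hy
    have hy' : S y = 0 := hy
    have := hS y
    rw [hy'] at this
    simpa using this.symm
  have hdet : LinearMap.det (S : V →ₗ[ℝ] V) ≠ 0 := by
    have := (LinearEquiv.ofInjectiveEndo (S : V →ₗ[ℝ] V) hinj).isUnit_det'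
    exact this.ne_zero
  set d : ℝ := |(LinearMap.det (S : V →ₗ[ℝ] V))⁻¹| with hd
  have hd0 : d ≠ 0 := by simpa [hd] using hdet
  have hemb : MeasurableEmbedding S := S.continuous.measurableEmbedding hinj
  have hcv : ∀ F : V → ℝ, ∫ x, F x = d⁻¹ * ∫ y, F (S y) := by
    intro F
    have h1 := Measure.map_linearMap_addHaar_eq_smul_addHaar (volume : Measure V) hdet
    have h2 : ∫ x, F x ∂(volume.map S) = ∫ y, F (S y) := hemb.integral_map F
    rw [← h2]
    change (∫ x, F x) = d⁻¹ * ∫ x, F x ∂(volume.map (S : V →ₗ[ℝ] V))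
    rw [h1, integral_smul_measure, ENNReal.toReal_ofReal (abs_nonneg _), ← hd, smul_eq_mul,
      inv_mul_cancel_left₀ hd0]
  refine ⟨d⁻¹, fun g => ?_⟩
  rw [stdGaussian_eq_withDensity, integral_withDensity_eq_integral_toReal_smul
    (by fun_prop) (ae_of_all _ fun x => ENNReal.ofReal_lt_top),
    integral_withDensity_eq_integral_toReal_smul
    (by fun_prop) (ae_of_all _ fun x => ENNReal.ofReal_lt_top), hcv]
  congr 2
  ext y
  have hI : 0 ≤ ∫ y : V, Real.exp (-‖y‖ ^ 2 / 2) := integral_nonneg fun y => (Real.exp_pos _).le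
  rw [ENNReal.toReal_ofReal (by positivity), ENNReal.toReal_ofReal (by positivity), smul_eq_mul,
    smul_eq_mul, ← hS y, show -(‖S y‖ ^ 2 - inner ℝ (T (S y)) (S y)) / 2 =
      -‖S y‖ ^ 2 / 2 + inner ℝ (T (S y)) (S y) / 2 by ring, Real.exp_add]
  ring

end Density

/-! ### Square roots of matrices -/

section Sqrt

open Matrix
open scoped MatrixOrder

lemma posSemidef_sub_one_of_mul_self {X : Matrix (Fin k) (Fin k) ℝ} (hX : X.PosSemidef)
    (hXX : (X * X - 1).PosSemidef) : (X - 1).PosSemidef := by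
  have hH : (X - 1).IsHermitian := hX.1.sub isHermitian_one
  rw [hH.posSemidef_iff_eigenvalues_nonneg]
  intro j
  set v : Fin k → ℝ := ⇑(hH.eigenvectorBasis j) with hv
  set m := hH.eigenvalues j with hm
  have hev : (X - 1) *ᵥ v = m • v := hH.mulVec_eigenvectorBasis j
  have hXv : X *ᵥ v = (1 + m) • v := by
    rw [sub_mulVec, one_mulVec] at hev
    rw [add_smul, one_smul, ← hev]; abel
  have hvv : 0 < v ⬝ᵥ v := by
    have hne : v ≠ 0 := by
      intro h
      have := hH.eigenvectorBasis.orthonormal.ne_zero j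
      exact this (by ext i; exact congrFun h i)
    have := dotProduct_star_self_pos_iff (v := v).2 hne
    simpa using this
  have h1 := hX.dotProduct_mulVec_nonneg v
  have h2 := hXX.dotProduct_mulVec_nonneg v
  rw [sub_mulVec, ← mulVec_mulVec, hXv, mulVec_smul, hXv, one_mulVec] at h2
  rw [hXv] at h1
  simp only [star_trivial, dotProduct_sub, dotProduct_smul, smul_eq_mul] at h1 h2
  have h3 : 0 ≤ 1 + m := nonneg_of_mul_nonneg_left h1 hvv
  have h4 : 0 ≤ (1 + m) * (1 + m) - 1 := by
    refine nonneg_of_mul_nonneg_left (b := v ⬝ᵥ v) ?_ hvv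
    linarith
  change 0 ≤ m
  nlinarith

lemma trace_transpose_mul (D E : Matrix (Fin k) (Fin k) ℝ) :
    (Dᵀ * E).trace = ∑ i, ∑ j, D i j * E i j := by
  rw [Finset.sum_comm]
  simp [Matrix.trace, Matrix.mul_apply]

/-- The square root is Lipschitz in the Frobenius norm at matrices that are at least `1`. -/
lemma sum_sq_sub_le_of_posSemidef {X Y : Matrix (Fin k) (Fin k) ℝ} (hX : (X - 1).PosSemidef)
    (hY : Y.PosSemidef) :
    ∑ i, ∑ j, (X - Y) i j ^ 2 ≤ ∑ i, ∑ j, (X * X - Y * Y) i j ^ 2 := by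
  set D := X - Y with hD
  set E := X * X - Y * Y with hE
  have hED : Dᵀ * E = Dᴴ * (X - 1) * D + Dᵀ * D + Dᵀ * (D * Y) := by
    rw [conjTranspose_eq_transpose_of_trivial, hE, hD]; noncomm_ring
  have h1 : 0 ≤ (Dᴴ * (X - 1) * D).trace := (hX.conjTranspose_mul_mul_same D).trace_nonneg
  have h2 : 0 ≤ (Dᵀ * (D * Y)).trace := by
    have := (hY.mul_mul_conjTranspose_same D).trace_nonneg
    rwa [conjTranspose_eq_transpose_of_trivial, trace_mul_comm] at this
  have h3 : (Dᵀ * D).trace ≤ (Dᵀ * E).trace := by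
    rw [hED, trace_add, trace_add]; linarith
  rw [trace_transpose_mul, trace_transpose_mul] at h3
  have h4 : ∑ i, ∑ j, D i j * E i j ≤ ∑ i, ∑ j, (D i j ^ 2 / 2 + E i j ^ 2 / 2) := by
    gcongr with i _ j _
    nlinarith [sq_nonneg (D i j - E i j)]
  simp only [Finset.sum_add_distrib, ← Finset.sum_div, ← pow_two] at h3 h4
  linarith

variable {M : Matrix (Fin k) (Fin k) ℝ}

lemma posDef_one_sub (hM : M.PosSemidef) (hn : opNorm M < 1) : (1 - M).PosDef := by
  refine PosDef.of_dotProduct_mulVec_pos (isHermitian_one.sub hM.1) fun x hx => ?_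
  have h1 := inner_toEuclideanCLM M (WithLp.toLp 2 x) (WithLp.toLp 2 x)
  have h2 := real_inner_le_norm (WithLp.toLp 2 x)
    (toEuclideanCLM (n := Fin k) (𝕜 := ℝ) M (WithLp.toLp 2 x))
  have h3 := (toEuclideanCLM (n := Fin k) (𝕜 := ℝ) M).le_opNorm (WithLp.toLp 2 x)
  change _ ≤ opNorm M * _ at h3
  have hx' : 0 < ‖(WithLp.toLp 2 x : EuclideanSpace ℝ (Fin k))‖ := by
    rw [norm_pos_iff]; simpa using hx
  have h4 : x ⬝ᵥ x = ‖(WithLp.toLp 2 x : EuclideanSpace ℝ (Fin k))‖ ^ 2 := by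
    rw [EuclideanSpace.real_norm_sq_eq]; simp [dotProduct, pow_two]
  rw [sub_mulVec, one_mulVec, star_trivial, dotProduct_sub, h4]
  rw [h1] at h2
  simp only at h2
  nlinarith [mul_le_mul_of_nonneg_left h3 hx'.le, mul_pos hx' hx']

lemma sqrt_mul_one_sub_mul_sqrt (hM : M.PosSemidef) (hn : opNorm M < 1) :
    CFC.sqrt (1 - M)⁻¹ * (1 - M) * CFC.sqrt (1 - M)⁻¹ = 1 := by
  have hpd := posDef_one_sub hM hn
  set S := CFC.sqrt (1 - M)⁻¹ with hS
  have hSS : S * S = (1 - M)⁻¹ := CFC.sqrt_mul_sqrt_self _ hpd.inv.posSemidef.nonneg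
  have hu : IsUnit (1 - M).det := (Matrix.isUnit_iff_isUnit_det _).1 hpd.isUnit
  have h1 : S * (S * (1 - M)) = 1 := by rw [← mul_assoc, hSS, nonsing_inv_mul _ hu]
  exact mul_eq_one_comm.1 h1

lemma posSemidef_sqrt_sub_one (hM : M.PosSemidef) (hn : opNorm M < 1) :
    (CFC.sqrt (1 - M)⁻¹ - 1).PosSemidef := by
  have h := sqrt_mul_one_sub_mul_sqrt hM hn
  have hpos : (CFC.sqrt (1 - M)⁻¹).PosSemidef :=
    nonneg_iff_posSemidef.1 (CFC.sqrt_nonneg _)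
  set S := CFC.sqrt (1 - M)⁻¹ with hS
  refine posSemidef_sub_one_of_mul_self hpos ?_
  have h2 : S * S - 1 = S * M * Sᴴ := by
    rw [hpos.1, ← h]; noncomm_ring
  rw [h2]
  exact hM.mul_mul_conjTranspose_same S

lemma inner_toEuclideanCLM_comm (hM : M.IsHermitian) (x y : EuclideanSpace ℝ (Fin k)) :
    inner ℝ (toEuclideanCLM (n := Fin k) (𝕜 := ℝ) M x) y =
      inner ℝ x (toEuclideanCLM (n := Fin k) (𝕜 := ℝ) M y) := by
  have h : IsSelfAdjoint (toEuclideanCLM (n := Fin k) (𝕜 := ℝ) M) := IsSelfAdjoint.map hM _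
  rw [← ContinuousLinearMap.adjoint_inner_right, h.adjoint_eq]

lemma norm_sqrtApply_sq_sub (hM : M.PosSemidef) (hn : opNorm M < 1)
    (y : EuclideanSpace ℝ (Fin k)) :
    ‖sqrtApply (1 - M)⁻¹ y‖ ^ 2 - inner ℝ (toEuclideanCLM (n := Fin k) (𝕜 := ℝ) M
      (sqrtApply (1 - M)⁻¹ y)) (sqrtApply (1 - M)⁻¹ y) = ‖y‖ ^ 2 := by
  have h := sqrt_mul_one_sub_mul_sqrt hM hn
  have hpos : (CFC.sqrt (1 - M)⁻¹).PosSemidef :=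
    nonneg_iff_posSemidef.1 (CFC.sqrt_nonneg _)
  unfold sqrtApply
  set S := CFC.sqrt (1 - M)⁻¹ with hS
  have h2 := congrArg (fun W => inner ℝ y (toEuclideanCLM (n := Fin k) (𝕜 := ℝ) W y)) h
  simp only [map_mul, map_sub, map_one, mul_apply_eq_comp, _root_.sub_apply,
    one_apply_eq_self] at h2
  rw [inner_sub_right, ← inner_toEuclideanCLM_comm hpos.1 y, ← inner_toEuclideanCLM_comm hpos.1 y,
    real_inner_self_eq_norm_sq, real_inner_self_eq_norm_sq] at h2
  rw [inner_toEuclideanCLM_comm hM.1]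
  exact h2

/-- `sqrtApply S` has second moment matrix `S` under the standard Gaussian measure. -/
lemma integral_sqrtApply_mul {S : Matrix (Fin k) (Fin k) ℝ} (hS : S.PosSemidef) (i j : Fin k) :
    ∫ y, sqrtApply S y i * sqrtApply S y j ∂(stdGaussian (EuclideanSpace ℝ (Fin k))) = S i j := by
  have h := covariance_eval_multivariateGaussian (μ := 0) hS i j
  have hm : ∀ i, ∫ x : EuclideanSpace ℝ (Fin k), x i ∂(multivariateGaussian 0 S) = 0 := by
    intro i
    have h1 := integral_id_multivariateGaussian (μ := (0 : EuclideanSpace ℝ (Fin k))) (S := S)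
    have h2 := ContinuousLinearMap.integral_comp_comm
      (EuclideanSpace.proj (𝕜 := ℝ) i : EuclideanSpace ℝ (Fin k) →L[ℝ] ℝ)
      (φ := fun x => x) (μ := multivariateGaussian 0 S) IsGaussian.integrable_id
    rw [h1] at h2
    simpa using h2
  rw [covariance, hm, hm] at h
  simp only [sub_zero] at h
  rw [multivariateGaussian, integral_map] at h
  · simpa [sqrtApply] using h
  · fun_prop
  · fun_prop

end Sqrt

/-! ### The block spin Ising model as a tilt of independent spins -/

/-- The matrix `Γ A Γ` with `Γ = diag (√(|Bᵢ| / N))`. -/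
noncomputable def scaledInteraction {N : ℕ} (A : Matrix (Fin k) (Fin k) ℝ) (b : Fin N → Fin k) :
    Matrix (Fin k) (Fin k) ℝ :=
  Matrix.diagonal (fun i => √(((block b i).card : ℝ) / (N : ℝ))) * A *
    Matrix.diagonal (fun i => √(((block b i).card : ℝ) / (N : ℝ)))

lemma posSemidef_scaledInteraction {N : ℕ} {A : Matrix (Fin k) (Fin k) ℝ} (hA : A.PosSemidef)
    (b : Fin N → Fin k) : (scaledInteraction A b).PosSemidef := by
  have h := hA.mul_mul_conjTranspose_same
    (Matrix.diagonal (fun i => √(((block b i).card : ℝ) / (N : ℝ))))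
  simpa [scaledInteraction, Matrix.diagonal_conjTranspose] using h

lemma sum_sum_block {N : ℕ} (A : Matrix (Fin k) (Fin k) ℝ) (b : Fin N → Fin k) (x : Fin N → ℝ) :
    ∑ v, ∑ w, A (b v) (b w) * x v * x w =
      ∑ i, ∑ j, A i j * (∑ v ∈ block b i, x v) * (∑ w ∈ block b j, x w) := by
  have h1 : ∀ F : Fin N → ℝ, ∑ v, F v = ∑ i, ∑ v ∈ block b i, F v := fun F =>
    (Finset.sum_fiberwise (s := Finset.univ) (g := b) F).symm
  have h2 : ∀ (i : Fin k), ∀ v ∈ block b i, b v = i := fun i v hv => by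
    simpa [block] using hv
  calc ∑ v, ∑ w, A (b v) (b w) * x v * x w
      = ∑ i, ∑ v ∈ block b i, ∑ j, ∑ w ∈ block b j, A i j * x v * x w := by
        rw [h1]
        refine Finset.sum_congr rfl fun i _ => Finset.sum_congr rfl fun v hv => ?_
        rw [h1]
        refine Finset.sum_congr rfl fun j _ => Finset.sum_congr rfl fun w hw => ?_
        rw [h2 i v hv, h2 j w hw]
    _ = _ := by
        refine Finset.sum_congr rfl fun i _ => ?_
        rw [Finset.sum_comm]
        refine Finset.sum_congr rfl fun j _ => ?_
        rw [mul_assoc, Finset.sum_mul_sum, Finset.mul_sum]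
        refine Finset.sum_congr rfl fun v _ => ?_
        rw [Finset.mul_sum]
        refine Finset.sum_congr rfl fun w _ => ?_
        ring

lemma hamiltonian_eq_halfForm {N : ℕ} (A : Matrix (Fin k) (Fin k) ℝ) (b : Fin N → Fin k)
    (hb : ∀ j, 0 < (block b j).card) (ε : Config N) :
    hamiltonian (blockInteraction A b) ε =
      halfForm (Matrix.toEuclideanCLM (n := Fin k) (𝕜 := ℝ) (scaledInteraction A b))
        (magnetization b ε) := by
  have hm : ∀ i, √(((block b i).card : ℝ) / (N : ℝ)) * magnetization b ε i =
      (∑ v ∈ block b i, spin ε v) / √(N : ℝ) := by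
    intro i
    have h0 : √((block b i).card : ℝ) ≠ 0 :=
      (Real.sqrt_pos.2 (by exact_mod_cast hb i)).ne'
    simp only [magnetization]
    rw [Real.sqrt_div (by positivity)]
    by_cases hN : √(N : ℝ) = 0
    · simp [hN]
    · field_simp
  have hN2 : √(N : ℝ) * √(N : ℝ) = N := Real.mul_self_sqrt (by positivity)
  rw [halfForm, real_inner_comm, Matrix.inner_toEuclideanCLM, hamiltonian]
  have hL : ∑ v, ∑ w, blockInteraction A b v w * spin ε v * spin ε w =
      ∑ i, ∑ j, A i j * ((∑ v ∈ block b i, spin ε v) / √(N : ℝ)) *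
        ((∑ v ∈ block b j, spin ε v) / √(N : ℝ)) := by
    have := sum_sum_block (fun i j => A i j / (N : ℝ)) b (spin ε)
    simp only [blockInteraction, Matrix.of_apply]
    rw [this]
    refine Finset.sum_congr rfl fun i _ => Finset.sum_congr rfl fun j _ => ?_
    rw [show A i j / (N : ℝ) = A i j / (√(N : ℝ) * √(N : ℝ)) by rw [hN2]]
    ring
  rw [hL]
  simp only [← hm, dotProduct, Matrix.mulVec, scaledInteraction, Matrix.mul_diagonal,
    Matrix.diagonal_mul, Finset.mul_sum, Finset.sum_div]
  refine Finset.sum_congr rfl fun i _ => Finset.sum_congr rfl fun j _ => ?_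
  ring

instance measurableSingletonClass_intUnits : MeasurableSingletonClass ℤˣ where
  measurableSet_singleton u := by
    have h : ({u} : Set ℤˣ) = (fun v : ℤˣ => (v : ℤ)) ⁻¹' {(u : ℤ)} := by
      ext v; simp [Units.ext_iff]
    rw [h]
    exact comap_measurable Units.val (measurableSet_singleton _)

lemma integral_isingMeasure {N : ℕ} (J : Matrix (Fin N) (Fin N) ℝ) (F : Config N → ℝ) :
    ∫ x, F x ∂(isingMeasure J) =
      ((∑ x, F x * Real.exp (hamiltonian J x)) / 2 ^ N) /
        ((∑ x, Real.exp (hamiltonian J x)) / 2 ^ N) := by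
  have hZ : 0 < partitionFunction J :=
    Finset.sum_pos (fun x _ => Real.exp_pos _) Finset.univ_nonempty
  rw [isingMeasure, integral_finsetSum_measure
    (fun x _ => Integrable.smul_measure Integrable.of_finite ENNReal.ofReal_ne_top)]
  simp only [integral_smul_measure, integral_dirac, smul_eq_mul]
  rw [div_div_div_cancel_right₀ (by positivity), Finset.sum_div]
  refine Finset.sum_congr rfl fun x _ => ?_
  rw [ENNReal.toReal_ofReal (by positivity)]
  change _ = _ / partitionFunction J
  ring

lemma testFunction_one : TestFunction (k := k) 1 (fun _ => 1) (fun _ _ => 0) (fun _ _ => 0)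
    (fun _ _ => 0) where
  continuous := continuous_const
  hasDerivAt₀ _ _ _ := hasDerivAt_const _ _
  hasDerivAt₁ _ _ _ := hasDerivAt_const _ _
  hasDerivAt₂ _ _ _ := hasDerivAt_const _ _
  bound₀ x := by simpa using one_le_pow₀ (n := 2) (by linarith [norm_nonneg x] : 1 ≤ 1 + ‖x‖)
  bound₁ _ _ := by simp; positivity
  bound₂ _ _ := by simp; positivity
  bound₃ _ _ := by simp; positivity

lemma abs_div_sub_le {a z w G X Y B : ℝ} (hz : 1 ≤ z) (h1 : |a - w * G| ≤ X)
    (h2 : |z - w| ≤ Y) (hG : |G| ≤ B) : |a / z - G| ≤ X + B * Y := by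
  have hz0 : 0 < z := by linarith
  have e1 : a / z - G = ((a - w * G) + G * (w - z)) / z := by field_simp; ring
  have e2 : |(a - w * G) + G * (w - z)| ≤ X + B * Y := by
    refine (abs_add_le _ _).trans (add_le_add h1 ?_)
    rw [abs_mul, abs_sub_comm w]
    exact mul_le_mul hG h2 (abs_nonneg _) ((abs_nonneg _).trans hG)
  rw [e1, abs_div, abs_of_pos hz0, div_le_iff₀ hz0]
  nlinarith [(abs_nonneg _).trans e2]

open scoped MatrixOrder in
/-- Gaussian approximation of the block magnetization vector, with covariance `(1 - Γ A Γ)⁻¹`. -/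
theorem exists_abs_integral_sub_le {l₀ : ℝ} (hl0 : 0 ≤ l₀) (hl1 : l₀ < 1) :
    ∃ K : ℝ, 0 ≤ K ∧ ∀ (A : Matrix (Fin k) (Fin k) ℝ) (N : ℕ) (b : Fin N → Fin k),
      A.PosSemidef → (∀ j, 0 < (block b j).card) → opNorm (scaledInteraction A b) ≤ l₀ →
      ∀ C g g₁ g₂ g₃, 0 ≤ C → TestFunction C g g₁ g₂ g₃ →
      |∫ x, g (magnetization b x) ∂(isingMeasure (blockInteraction A b)) -
        ∫ y, g (sqrtApply (1 - scaledInteraction A b)⁻¹ y)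
          ∂(stdGaussian (EuclideanSpace ℝ (Fin k)))| ≤
      K * C * ∑ j, (√((block b j).card : ℝ))⁻¹ := by
  set l := (l₀ + 1) / 2 with hl
  set e := (1 - l) / 2 with he
  have hl' : 0 ≤ l := by linarith
  have hle : l / (1 - e) < 1 := by rw [div_lt_one (by linarith)]; linarith
  have he0 : 0 < e := by linarith
  have he1 : e < 1 := by linarith
  obtain ⟨K₀, hK₀, hK⟩ := exists_tilt_bounds (k := k) (l := l) (by linarith : l₀ < l) hl1
  set W := ((√(1 - l / (1 - e)))⁻¹) ^ k with hW
  have hW0 : 0 ≤ W := by positivity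
  have hTM : 0 ≤ thirdMomentConst e := by unfold thirdMomentConst; positivity
  set K₁ := K₀ * (2 + 2 * thirdMomentConst e) * W with hK₁
  have hK₁0 : 0 ≤ K₁ := by positivity
  refine ⟨K₁ + K₀ * W * K₁, by positivity, fun A N b hA hb hn C g g₁ g₂ g₃ hC hg => ?_⟩
  have hM := posSemidef_scaledInteraction hA b
  set M := scaledInteraction A b with hMdef
  set T := Matrix.toEuclideanCLM (n := Fin k) (𝕜 := ℝ) M with hT
  have hsymm : ∀ x y, inner ℝ (T x) y = inner ℝ x (T y) := inner_toEuclideanCLM_comm hM.1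
  set err := ∑ j, (√((block b j).card : ℝ))⁻¹ with herr
  have herr0 : 0 ≤ err := Finset.sum_nonneg fun j _ => by positivity
  have key : ∀ C g g₁ g₂ g₃, 0 ≤ C → TestFunction (k := k) C g g₁ g₂ g₃ →
      Integrable (fun x => g x * Real.exp (halfForm T x))
        (stdGaussian (EuclideanSpace ℝ (Fin k))) ∧
      |∫ x, g x * Real.exp (halfForm T x) ∂(stdGaussian (EuclideanSpace ℝ (Fin k)))| ≤
        K₀ * C * W ∧
      |(∑ ε, g (magnetization b ε) * Real.exp (hamiltonian (blockInteraction A b) ε)) / 2 ^ N -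
        ∫ x, g x * Real.exp (halfForm T x) ∂(stdGaussian (EuclideanSpace ℝ (Fin k)))| ≤
        K₁ * C * err := by
    intro C g g₁ g₂ g₃ hC hg
    obtain ⟨h1, f₁, f₂, h2⟩ := hK T hsymm hn C g g₁ g₂ g₃ hC hg
    have hgc := hg.continuous
    obtain ⟨a1, a2, a3⟩ := abs_avg_magnetization_sub_integral_le hl' he0 he1 hle
      (f := fun x => g x * Real.exp (halfForm T x)) (by fun_prop) (by positivity : 0 ≤ K₀ * C)
      h1 h2 b hb
    refine ⟨a1, a2, ?_⟩
    simp only [hamiltonian_eq_halfForm A b hb]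
    refine a3.trans (le_of_eq ?_)
    rw [hK₁]; ring
  obtain ⟨i1, b1, c1⟩ := key C g g₁ g₂ g₃ hC hg
  obtain ⟨i2, b2, c2⟩ := key 1 _ _ _ _ zero_le_one testFunction_one
  simp only [one_mul, mul_one] at i2 b2 c2
  have hq0 : ∀ x, 0 ≤ halfForm T x := by
    intro x
    rw [halfForm, real_inner_comm, hT, Matrix.inner_toEuclideanCLM]
    have := hM.dotProduct_mulVec_nonneg x
    rw [star_trivial] at this
    positivity
  obtain ⟨zc, hzc⟩ := exists_integral_tilt_eq T
    (Matrix.toEuclideanCLM (n := Fin k) (𝕜 := ℝ) (CFC.sqrt (1 - M)⁻¹))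
    (norm_sqrtApply_sq_sub hM (hn.trans_lt hl1))
  have hz1 : ∫ x, Real.exp (halfForm T x) ∂(stdGaussian (EuclideanSpace ℝ (Fin k))) = zc := by
    have := hzc (fun _ => 1)
    simpa [halfForm] using this
  have hzc1 : 1 ≤ zc := by
    rw [← hz1]
    calc (1 : ℝ) = ∫ x, (1 : ℝ) ∂(stdGaussian (EuclideanSpace ℝ (Fin k))) := by simp
      _ ≤ _ := integral_mono (integrable_const _) i2 fun x => Real.one_le_exp (hq0 x)
  have hga : ∫ x, g x * Real.exp (halfForm T x) ∂(stdGaussian (EuclideanSpace ℝ (Fin k))) =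
      zc * ∫ y, g (sqrtApply (1 - M)⁻¹ y) ∂(stdGaussian (EuclideanSpace ℝ (Fin k))) := hzc g
  rw [integral_isingMeasure]
  set a := (∑ ε, g (magnetization b ε) * Real.exp (hamiltonian (blockInteraction A b) ε)) / 2 ^ N
  set z := (∑ ε, Real.exp (hamiltonian (blockInteraction A b) ε)) / 2 ^ N with hz
  have hz1' : 1 ≤ z := by
    rw [hz, le_div_iff₀ (by positivity)]
    calc (1 : ℝ) * 2 ^ N = ∑ _ε : Config N, (1 : ℝ) := by simp
      _ ≤ _ := Finset.sum_le_sum fun ε _ => by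
        rw [hamiltonian_eq_halfForm A b hb]
        exact Real.one_le_exp (hq0 _)
  set G := ∫ y, g (sqrtApply (1 - M)⁻¹ y) ∂(stdGaussian (EuclideanSpace ℝ (Fin k)))
  rw [hga] at b1 c1
  rw [hz1] at c2
  have hG : |G| ≤ K₀ * C * W := by
    rw [abs_mul, abs_of_nonneg (by linarith : (0 : ℝ) ≤ zc)] at b1
    nlinarith [abs_nonneg G]
  refine (abs_div_sub_le hz1' c1 c2 hG).trans (le_of_eq ?_)
  ring

/-! ### Test functions -/

lemma abs_apply_le_norm (x : EuclideanSpace ℝ (Fin k)) (i : Fin k) : |x i| ≤ ‖x‖ :=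
  PiLp.norm_apply_le x i

lemma hasDerivAt_coord (x : EuclideanSpace ℝ (Fin k)) (i p : Fin k) (t : ℝ) :
    HasDerivAt (fun s : ℝ => (x + EuclideanSpace.single i s) p)
      (if p = i then 1 else 0) t := by
  have h := (EuclideanSpace.proj (𝕜 := ℝ) p :
    EuclideanSpace ℝ (Fin k) →L[ℝ] ℝ).hasFDerivAt.comp_hasDerivAt t (hasDerivAt_single x i t)
  refine h.congr_deriv ?_
  simp

lemma testFunction_coord_mul (p q : Fin k) :
    TestFunction (k := k) 2 (fun x => x p * x q)
      (fun i x => (if p = i then 1 else 0) * x q + x p * (if q = i then 1 else 0))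
      (fun i _ => 2 * ((if p = i then 1 else 0) * (if q = i then 1 else 0))) (fun _ _ => 0) where
  continuous := by fun_prop
  hasDerivAt₀ i x t := (hasDerivAt_coord x i p t).mul (hasDerivAt_coord x i q t)
  hasDerivAt₁ i x t := by
    refine (((hasDerivAt_coord x i q t).const_mul _).add
      ((hasDerivAt_coord x i p t).mul_const _)).congr_deriv ?_
    ring
  hasDerivAt₂ _ _ _ := hasDerivAt_const _ _
  bound₀ x := by
    rw [abs_mul]
    nlinarith [mul_le_mul (abs_apply_le_norm x p) (abs_apply_le_norm x q) (abs_nonneg _)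
      (norm_nonneg x), norm_nonneg x]
  bound₁ i x := by
    have h1 := abs_apply_le_norm x p
    have h2 := abs_apply_le_norm x q
    have h3 : ‖x‖ ≤ (1 + ‖x‖) ^ 2 := by nlinarith [norm_nonneg x]
    refine (abs_add_le _ _).trans ?_
    have h4 : |(if p = i then (1 : ℝ) else 0) * x q| ≤ ‖x‖ := by
      split_ifs <;> simp [h2]
    have h5 : |x p * (if q = i then (1 : ℝ) else 0)| ≤ ‖x‖ := by
      split_ifs <;> simp [h1]
    linarith
  bound₂ i x := by
    have h3 : 1 ≤ (1 + ‖x‖) ^ 2 := one_le_pow₀ (by linarith [norm_nonneg x])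
    have h4 : |2 * ((if p = i then (1 : ℝ) else 0) * (if q = i then 1 else 0))| ≤ 2 := by
      split_ifs <;> norm_num
    linarith
  bound₃ _ _ := by simp; positivity

lemma sum_abs_le_norm (x : EuclideanSpace ℝ (Fin k)) : ∑ i, |x i| ≤ k * ‖x‖ := by
  calc ∑ i, |x i| ≤ ∑ _i : Fin k, ‖x‖ := Finset.sum_le_sum fun i _ => abs_apply_le_norm x i
    _ = _ := by simp

lemma abs_sub_le_of_mem_F₃ {h : EuclideanSpace ℝ (Fin k) → ℝ} (hh : h ∈ F₃ k)
    (x y : EuclideanSpace ℝ (Fin k)) : |h x - h y| ≤ ∑ i, |(x - y) i| := by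
  have hd : Differentiable ℝ h := hh.1.differentiable (by norm_num)
  have hb : ∀ z i, |fderiv ℝ h z (EuclideanSpace.single i 1)| ≤ 1 := by
    intro z i
    have := hh.2 1 (by simp) (fun _ => i) z
    rwa [iteratedFDeriv_one_apply] at this
  have hv : ∀ z, ‖fderiv ℝ h z (x - y)‖ ≤ ∑ i, |(x - y) i| := by
    intro z
    have hs : x - y = ∑ i, (x - y) i • EuclideanSpace.single i (1 : ℝ) := by
      ext j; simp [Pi.single_apply]
    rw [hs, map_sum, ← hs]
    refine (norm_sum_le _ _).trans (Finset.sum_le_sum fun i _ => ?_)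
    rw [map_smul, smul_eq_mul, norm_mul, Real.norm_eq_abs, Real.norm_eq_abs]
    exact mul_le_of_le_one_right (abs_nonneg _) (hb z i)
  have hline : ∀ t : ℝ, HasDerivAt (fun s : ℝ => h (y + s • (x - y)))
      (fderiv ℝ h (y + t • (x - y)) (x - y)) t := fun t => by
    have h1 : HasDerivAt (fun s : ℝ => y + s • (x - y)) (x - y) t := by
      simpa using ((hasDerivAt_id t).smul_const (x - y)).const_add y
    exact (hd _).hasFDerivAt.comp_hasDerivAt t h1
  have := Convex.norm_image_sub_le_of_norm_hasDerivWithin_le (s := Set.univ)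
    (fun t _ => (hline t).hasDerivWithinAt) (fun t _ => hv _) convex_univ (Set.mem_univ 0)
    (Set.mem_univ 1)
  simpa using this

lemma hasDerivAt_iteratedFDeriv_single {h : EuclideanSpace ℝ (Fin k) → ℝ} (hh : ContDiff ℝ 3 h)
    {m : ℕ} (hm : m < 3) (i : Fin k) (x : EuclideanSpace ℝ (Fin k)) (t : ℝ) :
    HasDerivAt (fun s : ℝ => iteratedFDeriv ℝ m h (x + EuclideanSpace.single i s)
      fun _ => EuclideanSpace.single i 1)
      (iteratedFDeriv ℝ (m + 1) h (x + EuclideanSpace.single i t)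
        fun _ => EuclideanSpace.single i 1) t := by
  have hd : Differentiable ℝ (iteratedFDeriv ℝ m h) :=
    hh.differentiable_iteratedFDeriv (by exact_mod_cast hm)
  have h1 := (hd (x + EuclideanSpace.single i t)).hasFDerivAt.comp_hasDerivAt t
    (hasDerivAt_single x i t)
  have h2 := (ContinuousMultilinearMap.apply ℝ (fun _ : Fin m => EuclideanSpace ℝ (Fin k)) ℝ
    fun _ => EuclideanSpace.single i 1).hasFDerivAt.comp_hasDerivAt t h1
  refine h2.congr_deriv ?_
  rw [iteratedFDeriv_succ_apply_left]
  rfl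

lemma testFunction_of_mem_F₃ {h : EuclideanSpace ℝ (Fin k) → ℝ} (hh : h ∈ F₃ k) :
    TestFunction (k + 1) (fun x => h x - h 0)
      (fun i x => iteratedFDeriv ℝ 1 h x fun _ => EuclideanSpace.single i 1)
      (fun i x => iteratedFDeriv ℝ 2 h x fun _ => EuclideanSpace.single i 1)
      (fun i x => iteratedFDeriv ℝ 3 h x fun _ => EuclideanSpace.single i 1) := by
  have hb : ∀ m ∈ Finset.Icc 1 3, ∀ (i : Fin k) x,
      |iteratedFDeriv ℝ m h x fun _ => EuclideanSpace.single i 1| ≤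
        ((k : ℝ) + 1) * (1 + ‖x‖) ^ 2 := by
    intro m hm i x
    have h3 : 1 ≤ (1 + ‖x‖) ^ 2 := one_le_pow₀ (by linarith [norm_nonneg x])
    have h4 : (0 : ℝ) ≤ k := by positivity
    exact (hh.2 m hm (fun _ => i) x).trans (by nlinarith)
  exact {
    continuous := by have := hh.1.continuous; fun_prop
    hasDerivAt₀ := fun i x t => by
      have := hasDerivAt_iteratedFDeriv_single hh.1 (m := 0) (by norm_num) i x t
      simp only [iteratedFDeriv_zero_apply] at this
      exact this.sub_const (h 0)
    hasDerivAt₁ := hasDerivAt_iteratedFDeriv_single hh.1 (by norm_num)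
    hasDerivAt₂ := hasDerivAt_iteratedFDeriv_single hh.1 (by norm_num)
    bound₀ := fun x => by
      have h1 := abs_sub_le_of_mem_F₃ hh x 0
      rw [sub_zero] at h1
      have h2 := sum_abs_le_norm x
      have h4 : (0 : ℝ) ≤ k := by positivity
      nlinarith [norm_nonneg x, mul_nonneg h4 (norm_nonneg x), sq_nonneg ‖x‖,
        mul_nonneg h4 (sq_nonneg ‖x‖)]
    bound₁ := hb 1 (by simp)
    bound₂ := hb 2 (by simp)
    bound₃ := hb 3 (by simp) }

/-! ### The second moment matrix and the final estimate -/

lemma integrable_isingMeasure {N : ℕ} (J : Matrix (Fin N) (Fin N) ℝ) (F : Config N → ℝ) :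
    Integrable F (isingMeasure J) := Integrable.of_finite

lemma posSemidef_covMatrix {N : ℕ} (A : Matrix (Fin k) (Fin k) ℝ) (b : Fin N → Fin k) :
    (covMatrix A b).PosSemidef := by
  refine Matrix.PosSemidef.of_dotProduct_mulVec_nonneg ?_ fun c => ?_
  · ext i j
    simp [covMatrix, mul_comm]
  · have h : star c ⬝ᵥ (covMatrix A b).mulVec c =
        ∫ x, (∑ i, c i * magnetization b x i) ^ 2 ∂(isingMeasure (blockInteraction A b)) := by
      have h1 : ∀ x, (∑ i, c i * magnetization b x i) ^ 2 =
          ∑ i, ∑ j, c i * (magnetization b x i * magnetization b x j * c j) := by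
        intro x
        rw [pow_two, Finset.sum_mul_sum]
        exact Finset.sum_congr rfl fun i _ => Finset.sum_congr rfl fun j _ => by ring
      simp only [h1]
      rw [integral_finsetSum _ fun i _ => integrable_isingMeasure _ _]
      simp only [dotProduct, Matrix.mulVec, star_trivial, covMatrix, Matrix.of_apply]
      refine Finset.sum_congr rfl fun i _ => ?_
      rw [integral_finsetSum _ fun j _ => integrable_isingMeasure _ _, Finset.mul_sum]
      refine Finset.sum_congr rfl fun j _ => ?_
      rw [integral_const_mul, integral_mul_const]
    rw [h]
    exact integral_nonneg fun x => sq_nonneg _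

lemma continuous_sqrtApply (S : Matrix (Fin k) (Fin k) ℝ) : Continuous (sqrtApply S) :=
  ContinuousLinearMap.continuous _

lemma integrable_norm_stdGaussian :
    Integrable (fun y => ‖y‖) (stdGaussian (EuclideanSpace ℝ (Fin k))) :=
  (IsGaussian.integrable_id (μ := stdGaussian (EuclideanSpace ℝ (Fin k)))).norm

lemma norm_sqrtApply_le (S : Matrix (Fin k) (Fin k) ℝ) :
    ∃ c, 0 ≤ c ∧ ∀ y, ‖sqrtApply S y‖ ≤ c * ‖y‖ :=
  ⟨_, norm_nonneg _, ContinuousLinearMap.le_opNorm _⟩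

lemma abs_sub_zero_le_of_mem_F₃ {h : EuclideanSpace ℝ (Fin k) → ℝ} (hh : h ∈ F₃ k)
    (x : EuclideanSpace ℝ (Fin k)) : |h x - h 0| ≤ k * ‖x‖ := by
  have h1 := abs_sub_le_of_mem_F₃ hh x 0
  rw [sub_zero] at h1
  exact h1.trans (sum_abs_le_norm x)

lemma integrable_comp_sqrtApply (S : Matrix (Fin k) (Fin k) ℝ)
    {h : EuclideanSpace ℝ (Fin k) → ℝ} (hh : h ∈ F₃ k) :
    Integrable (fun y => h (sqrtApply S y)) (stdGaussian (EuclideanSpace ℝ (Fin k))) := by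
  obtain ⟨c, hc, hS⟩ := norm_sqrtApply_le S
  refine ((integrable_const |h 0|).add (integrable_norm_stdGaussian.const_mul (k * c))).mono'
    (hh.1.continuous.comp (continuous_sqrtApply S)).aestronglyMeasurable (ae_of_all _ fun y => ?_)
  have h1 := abs_sub_zero_le_of_mem_F₃ hh (sqrtApply S y)
  have h2 := mul_le_mul_of_nonneg_left (hS y) (by positivity : (0 : ℝ) ≤ k)
  have h3 := abs_add_le (h 0) (h (sqrtApply S y) - h 0)
  rw [add_sub_cancel] at h3
  simp only [Real.norm_eq_abs, Pi.add_apply]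
  linarith

section Law

variable {Ω : Type*} [MeasurableSpace Ω] {P : Measure Ω} {Z : Ω → EuclideanSpace ℝ (Fin k)}

lemma integrable_comp_sqrtApply_of_hasLaw
    (hZ : HasLaw Z (stdGaussian (EuclideanSpace ℝ (Fin k))) P) (S : Matrix (Fin k) (Fin k) ℝ)
    {h : EuclideanSpace ℝ (Fin k) → ℝ} (hh : h ∈ F₃ k) :
    Integrable (fun ω => h (sqrtApply S (Z ω))) P := by
  have h1 := integrable_comp_sqrtApply S hh
  rw [← hZ.map_eq] at h1
  exact h1.comp_aemeasurable hZ.aemeasurable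

lemma discrepancy_eq (hZ : HasLaw Z (stdGaussian (EuclideanSpace ℝ (Fin k))) P) {N : ℕ}
    (A : Matrix (Fin k) (Fin k) ℝ) (b : Fin N → Fin k)
    {h : EuclideanSpace ℝ (Fin k) → ℝ} (hh : h ∈ F₃ k) :
    discrepancy A b P Z h =
      |(∫ x, (h (magnetization b x) - h 0) ∂(isingMeasure (blockInteraction A b))) -
        ∫ y, (h (sqrtApply (covMatrix A b) y) - h 0)
          ∂(stdGaussian (EuclideanSpace ℝ (Fin k)))| := by
  have h1 := integrable_comp_sqrtApply (covMatrix A b) hh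
  have h2 : ∫ ω, h (sqrtApply (covMatrix A b) (Z ω)) ∂P =
      ∫ y, h (sqrtApply (covMatrix A b) y) ∂(stdGaussian (EuclideanSpace ℝ (Fin k))) := by
    have h3 := h1.aestronglyMeasurable
    rw [← hZ.map_eq] at h3 ⊢
    exact (integral_map hZ.aemeasurable h3).symm
  rw [discrepancy, h2, integral_sub (integrable_isingMeasure _ _) (integrable_const _),
    integral_sub h1 (integrable_const _)]
  congr 1
  simp

lemma bddAbove_discrepancy (hZ : HasLaw Z (stdGaussian (EuclideanSpace ℝ (Fin k))) P) {N : ℕ}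
    (A : Matrix (Fin k) (Fin k) ℝ) (b : Fin N → Fin k) :
    BddAbove (Set.range fun h : F₃ k => discrepancy A b P Z h) := by
  obtain ⟨c, hc, hS⟩ := norm_sqrtApply_le (covMatrix A b)
  refine ⟨(∫ x, k * ‖magnetization b x‖ ∂(isingMeasure (blockInteraction A b))) +
    ∫ y, k * c * ‖y‖ ∂(stdGaussian (EuclideanSpace ℝ (Fin k))), ?_⟩
  rintro _ ⟨⟨h, hh⟩, rfl⟩
  simp only
  rw [discrepancy_eq hZ A b hh]
  refine (abs_sub _ _).trans (add_le_add ?_ ?_)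
  · rw [← Real.norm_eq_abs]
    exact norm_integral_le_of_norm_le (integrable_isingMeasure _ _)
      (ae_of_all _ fun x => abs_sub_zero_le_of_mem_F₃ hh _)
  · rw [← Real.norm_eq_abs]
    refine norm_integral_le_of_norm_le (integrable_norm_stdGaussian.const_mul _)
      (ae_of_all _ fun y => ?_)
    have h1 := abs_sub_zero_le_of_mem_F₃ hh (sqrtApply (covMatrix A b) y)
    have h2 := mul_le_mul_of_nonneg_left (hS y) (by positivity : (0 : ℝ) ≤ k)
    rw [Real.norm_eq_abs]
    linarith

open scoped MatrixOrder in
/-- Comparison of the Gaussian expectations for two covariance matrices. -/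
lemma abs_integral_sqrtApply_sub_le {M Y : Matrix (Fin k) (Fin k) ℝ} (hM : M.PosSemidef)
    (hn : opNorm M < 1) (hY : Y.PosSemidef) {r : ℝ} (hr : 0 ≤ r)
    (hMY : ∀ i j, |Y i j - (1 - M)⁻¹ i j| ≤ r)
    {h : EuclideanSpace ℝ (Fin k) → ℝ} (hh : h ∈ F₃ k) :
    |∫ y, (h (sqrtApply (1 - M)⁻¹ y) - h 0) ∂(stdGaussian (EuclideanSpace ℝ (Fin k))) -
      ∫ y, (h (sqrtApply Y y) - h 0) ∂(stdGaussian (EuclideanSpace ℝ (Fin k)))| ≤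
      k ^ 3 * (∫ y, ‖y‖ ∂(stdGaussian (EuclideanSpace ℝ (Fin k)))) * r := by
  have hinv : (1 - M)⁻¹.PosSemidef := (posDef_one_sub hM hn).inv.posSemidef
  set X := CFC.sqrt (1 - M)⁻¹ with hX
  set R := CFC.sqrt Y with hR
  have hXX : X * X = (1 - M)⁻¹ := CFC.sqrt_mul_sqrt_self _ hinv.nonneg
  have hRR : R * R = Y := CFC.sqrt_mul_sqrt_self _ hY.nonneg
  have hRpos : R.PosSemidef := Matrix.nonneg_iff_posSemidef.1 (CFC.sqrt_nonneg _)
  have hfro := sum_sq_sub_le_of_posSemidef (posSemidef_sqrt_sub_one hM hn) hRpos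
  rw [← hX, hXX, hRR] at hfro
  have hD : ∀ i j, |(X - R) i j| ≤ k * r := by
    intro i j
    have h1 : (X - R) i j ^ 2 ≤ ∑ i, ∑ j, (X - R) i j ^ 2 :=
      (Finset.single_le_sum (f := fun j => (X - R) i j ^ 2) (fun _ _ => sq_nonneg _)
        (Finset.mem_univ j)).trans
      (Finset.single_le_sum (f := fun i => ∑ j, (X - R) i j ^ 2)
        (fun _ _ => Finset.sum_nonneg fun _ _ => sq_nonneg _) (Finset.mem_univ i))
    have h2 : ∑ i, ∑ j, ((1 - M)⁻¹ - Y) i j ^ 2 ≤ ∑ _i : Fin k, ∑ _j : Fin k, r ^ 2 := by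
      refine Finset.sum_le_sum fun i _ => Finset.sum_le_sum fun j _ => ?_
      rw [← sq_abs, Matrix.sub_apply, abs_sub_comm]
      exact pow_le_pow_left₀ (abs_nonneg _) (hMY i j) 2
    simp only [Finset.sum_const, Finset.card_univ, Fintype.card_fin, nsmul_eq_mul] at h2
    apply abs_le_of_sq_le_sq _ (by positivity)
    nlinarith
  have h_integrable : ∀ S : Matrix (Fin k) (Fin k) ℝ, Integrable (fun y => h (sqrtApply S y) - h 0)
      (stdGaussian (EuclideanSpace ℝ (Fin k))) := fun S =>
    (integrable_comp_sqrtApply S hh).sub (integrable_const _)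
  rw [← integral_sub (h_integrable _) (h_integrable _)]
  have hpt : ∀ y, ‖(h (sqrtApply (1 - M)⁻¹ y) - h 0) - (h (sqrtApply Y y) - h 0)‖ ≤
      k ^ 3 * r * ‖y‖ := by
    intro y
    rw [sub_sub_sub_cancel_right, Real.norm_eq_abs]
    refine (abs_sub_le_of_mem_F₃ hh _ _).trans ?_
    have hc : ∀ i, |(sqrtApply (1 - M)⁻¹ y - sqrtApply Y y) i| ≤ k * (k * r * ‖y‖) := by
      intro i
      have h1 : (sqrtApply (1 - M)⁻¹ y - sqrtApply Y y) i = ∑ j, (X - R) i j * y j := by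
        change (X.mulVec y.ofLp) i - (R.mulVec y.ofLp) i = _
        simp [Matrix.mulVec, dotProduct, sub_mul, Finset.sum_sub_distrib]
      rw [h1]
      refine (Finset.abs_sum_le_sum_abs _ _).trans ?_
      calc ∑ j, |(X - R) i j * y j| ≤ ∑ _j : Fin k, k * r * ‖y‖ := by
            gcongr with j _
            rw [abs_mul]
            exact mul_le_mul (hD i j) (abs_apply_le_norm y j) (abs_nonneg _) (by positivity)
        _ = _ := by simp
    calc _ ≤ ∑ _i : Fin k, k * (k * r * ‖y‖) := Finset.sum_le_sum fun i _ => hc i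
      _ = k ^ 3 * r * ‖y‖ := by simp; ring
  refine (norm_integral_le_of_norm_le (integrable_norm_stdGaussian.const_mul _)
    (ae_of_all _ hpt)).trans (le_of_eq ?_)
  rw [integral_const_mul]
  ring

/-- The bound on the discrepancy in terms of the block sizes. -/
theorem exists_discrepancy_le (hZ : HasLaw Z (stdGaussian (EuclideanSpace ℝ (Fin k))) P)
    {l₀ : ℝ} (hl0 : 0 ≤ l₀) (hl1 : l₀ < 1) :
    ∃ K : ℝ, 0 ≤ K ∧ ∀ (A : Matrix (Fin k) (Fin k) ℝ) (N : ℕ) (b : Fin N → Fin k), A.PosSemidef →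
      (∀ j, 0 < (block b j).card) → opNorm (scaledInteraction A b) ≤ l₀ →
      ∀ h ∈ F₃ k, discrepancy A b P Z h ≤ K * ∑ j, (√((block b j).card : ℝ))⁻¹ := by
  obtain ⟨K, hK0, hK⟩ := exists_abs_integral_sub_le (k := k) hl0 hl1
  set c := ∫ y, ‖y‖ ∂(stdGaussian (EuclideanSpace ℝ (Fin k))) with hc
  have hc0 : 0 ≤ c := integral_nonneg fun y => norm_nonneg y
  clear_value c
  refine ⟨K * (k + 1) + k ^ 3 * c * (K * 2), by positivity,
    fun A N b hA hb hn h hh => ?_⟩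
  set err := ∑ j, (√((block b j).card : ℝ))⁻¹ with herr
  have herr0 : 0 ≤ err := Finset.sum_nonneg fun j _ => by positivity
  clear_value err
  have hM := posSemidef_scaledInteraction hA b
  have hM1 := hn.trans_lt hl1
  have h1 := hK A N b hA hb hn _ _ _ _ _ (by positivity) (testFunction_of_mem_F₃ hh)
  have h2 : ∀ i j, |covMatrix A b i j - (1 - scaledInteraction A b)⁻¹ i j| ≤ K * 2 * err := by
    intro i j
    have h3 := hK A N b hA hb hn _ _ _ _ _ zero_le_two (testFunction_coord_mul i j)
    rwa [integral_sqrtApply_mul (posDef_one_sub hM hM1).inv.posSemidef, ← herr] at h3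
  have h4 := abs_integral_sqrtApply_sub_le hM hM1 (posSemidef_covMatrix A b)
    (by positivity) h2 hh
  rw [← hc] at h4
  rw [← herr] at h1
  rw [discrepancy_eq hZ A b hh]
  refine (abs_sub_le _ _ _).trans ((add_le_add h1 h4).trans (le_of_eq ?_))
  ring

end Law

lemma continuous_opNorm : Continuous (opNorm (k := k)) := by
  have h : Continuous fun M : Matrix (Fin k) (Fin k) ℝ =>
      Matrix.toEuclideanCLM (n := Fin k) (𝕜 := ℝ) M :=
    LinearMap.continuous_of_finiteDimensional
      (Matrix.toEuclideanCLM (n := Fin k) (𝕜 := ℝ)).toAlgEquiv.toLinearMap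
  exact h.norm

lemma tendsto_opNorm_scaledInteraction (A : Matrix (Fin k) (Fin k) ℝ) {N : ℕ → ℕ}
    (b : (n : ℕ) → Fin (N n) → Fin k) {γ : Fin k → ℝ}
    (hlim : ∀ i, Tendsto (fun n => √(((block (b n) i).card : ℝ) / (N n : ℝ))) atTop (𝓝 (γ i))) :
    Tendsto (fun n => opNorm (scaledInteraction A (b n))) atTop
      (𝓝 (opNorm (Matrix.diagonal γ * A * Matrix.diagonal γ))) := by
  have hd : Tendsto (fun n i => √(((block (b n) i).card : ℝ) / (N n : ℝ))) atTop (𝓝 γ) :=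
    tendsto_pi_nhds.2 hlim
  have hc : Continuous fun d : Fin k → ℝ =>
      opNorm (Matrix.diagonal d * A * Matrix.diagonal d) :=
    continuous_opNorm.comp (by fun_prop)
  exact (hc.tendsto γ).comp hd

lemma inv_sqrt_card_le {N m : ℕ} {g : ℝ} (hg : 0 < g) (h : g / 2 < √((m : ℝ) / (N : ℝ))) :
    0 < m ∧ (√(m : ℝ))⁻¹ ≤ 2 / g * (N : ℝ) ^ (-(1 / 2 : ℝ)) := by
  have h0 : 0 < √((m : ℝ) / (N : ℝ)) := by linarith
  rw [Real.sqrt_pos] at h0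
  have hN : (0 : ℝ) < N := by
    rcases Nat.eq_zero_or_pos N with h' | h'
    · simp [h'] at h0
    · exact_mod_cast h'
  have hm : (0 : ℝ) < m := by
    rcases Nat.eq_zero_or_pos m with h' | h'
    · simp [h'] at h0
    · exact_mod_cast h'
  refine ⟨by exact_mod_cast hm, ?_⟩
  have hN' : 0 < √(N : ℝ) := Real.sqrt_pos.2 hN
  have hm' : 0 < √(m : ℝ) := Real.sqrt_pos.2 hm
  rw [Real.sqrt_div hm.le, lt_div_iff₀ hN'] at h
  rw [Real.rpow_neg hN.le, ← Real.sqrt_eq_rpow, ← div_eq_mul_inv, div_div, le_div_iff₀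
    (by positivity), inv_mul_eq_div, div_le_iff₀ hm']
  linarith

end BlockIsing

theorem theorem1p5 {k : ℕ} (A : Matrix (Fin k) (Fin k) ℝ) (hA : A.PosDef)
    (N : ℕ → ℕ) (hN : StrictMono N) (b : (n : ℕ) → Fin (N n) → Fin k)
    (γ : Fin k → ℝ) (hγ : ∀ i, 0 < γ i)
    (hlim : ∀ i, Tendsto (fun n => √(((BlockIsing.block (b n) i).card : ℝ) / (N n : ℝ)))
      atTop (𝓝 (γ i)))
    (hnorm : BlockIsing.opNorm (Matrix.diagonal γ * A * Matrix.diagonal γ) < 1)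
    {Ω : Type*} [MeasurableSpace Ω] (P : Measure Ω) (Z : Ω → EuclideanSpace ℝ (Fin k))
    (hZ : HasLaw Z (stdGaussian (EuclideanSpace ℝ (Fin k))) P) :
    (∀ n, ∀ h ∈ BlockIsing.F₃ k,
      Integrable (fun ω => h (BlockIsing.sqrtApply (BlockIsing.covMatrix A (b n)) (Z ω))) P) ∧
    (∀ n, BddAbove (Set.range
      fun h : BlockIsing.F₃ k => BlockIsing.discrepancy A (b n) P Z h)) ∧
    (fun n => ⨆ h : BlockIsing.F₃ k, BlockIsing.discrepancy A (b n) P Z h)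
      =O[atTop] (fun n => (N n : ℝ) ^ (-(1 / 2 : ℝ))) := by
  refine ⟨fun n h hh => BlockIsing.integrable_comp_sqrtApply_of_hasLaw hZ _ hh,
    fun n => BlockIsing.bddAbove_discrepancy hZ A (b n), ?_⟩
  obtain ⟨l₀, hl, hl1⟩ := exists_between hnorm
  have hl0 : 0 ≤ l₀ := (norm_nonneg _).trans hl.le
  obtain ⟨K, hK0, hK⟩ := BlockIsing.exists_discrepancy_le hZ hl0 hl1
  refine IsBigO.of_bound (K * ∑ i, 2 / γ i) ?_
  have h1 := (BlockIsing.tendsto_opNorm_scaledInteraction A b hlim).eventually_lt_const hl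
  have h2 : ∀ᶠ n in atTop, ∀ i,
      γ i / 2 < √(((BlockIsing.block (b n) i).card : ℝ) / (N n : ℝ)) :=
    eventually_all.2 fun i => (hlim i).eventually_const_lt (half_lt_self (hγ i))
  filter_upwards [h1, h2] with n hn1 hn2
  have hcard := fun i => BlockIsing.inv_sqrt_card_le (hγ i) (hn2 i)
  have hr : 0 ≤ (N n : ℝ) ^ (-(1 / 2 : ℝ)) := by positivity
  have hsup : 0 ≤ ⨆ h : BlockIsing.F₃ k, BlockIsing.discrepancy A (b n) P Z h :=
    Real.iSup_nonneg fun h => abs_nonneg _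
  rw [Real.norm_of_nonneg hsup, Real.norm_of_nonneg hr]
  have hγs : 0 ≤ ∑ i, 2 / γ i := Finset.sum_nonneg fun i _ => by have := hγ i; positivity
  refine Real.iSup_le (fun h => ?_) (by positivity)
  refine (hK A (N n) (b n) hA.posSemidef (fun i => (hcard i).1) hn1.le h h.2).trans ?_
  rw [mul_assoc, Finset.sum_mul]
  exact mul_le_mul_of_nonneg_left (Finset.sum_le_sum fun i _ => (hcard i).2) hK0
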